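/- For each $n \ge 1$ let $p = p_n \ge 1$ be an integer and let $\mathbf{X}_1, \dots, \mathbf{X}_n$ be independent random points, each uniformly distributed on the unit sphere $\mathbb{S}^{p-1}$ of $\mathbb{R}^p$. For $1 \le i < j \le n$ let $\Theta_{ij} \in [0,\pi]$ be the angle between the vectors $\mathbf{X}_i$ and $\mathbf{X}_j$, and, for $n \ge 2$, put $\Theta_{\min} = \min_{1 \le i<j\le n} \Theta_{ij}$ and $\Theta_{\max} = \max_{1\le i<j\le n} \Theta_{ij}$. Suppose that $p_n \to \infty$ and $\frac{\log n}{p_n} \to 0$ as $n \to \infty$. Then: (i) $\max_{1 \le i<j\le n} \left|\Theta_{ij} - \frac{\pi}{2}\right| \to 0$ in probability as $n \to \infty$; (ii) as $n\to\infty$, $2p_n \log \sin \Theta_{\min} + 4 \log n - \log\log n$ converges weakly to the probability distribution on $\mathbb{R}$ with distribution function $F(y) = 1 - e^{-K e^{y/2}}$, $y \in \mathbb{R}$, where $K = \frac{1}{4\sqrt{2\pi}}$; the same conclusion holds with $\Theta_{\min}$ replaced by $\Theta_{\max}$. -/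

import Mathlib

open MeasureTheory ProbabilityTheory Filter Topology

noncomputable section

/-- The unit sphere `𝕊^{p-1}` of the Euclidean space `ℝ^p`. -/
abbrev UnitSphere (p : ℕ) : Type := Metric.sphere (0 : EuclideanSpace ℝ (Fin p)) 1

/-- The uniform distribution on the unit sphere of `ℝ^p`: the surface measure induced by
Lebesgue measure, normalized to total mass one. -/
def uniformSphere (p : ℕ) : Measure (UnitSphere p) :=
  ((volume : Measure (EuclideanSpace ℝ (Fin p))).toSphere Set.univ)⁻¹ •
    (volume : Measure (EuclideanSpace ℝ (Fin p))).toSphere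

/-- The index set of pairs `i < j` among `n` indices. -/
abbrev PairIdx (n : ℕ) : Type := {q : Fin n × Fin n // q.1 < q.2}

/-- The angle in `[0, π]` between the `i`-th and the `j`-th point, for a pair `q = (i, j)`. -/
def pairAngle {n p : ℕ} (x : Fin n → UnitSphere p) (q : PairIdx n) : ℝ :=
  InnerProductGeometry.angle (x q.1.1 : EuclideanSpace ℝ (Fin p)) (x q.1.2)

/-- The smallest pairwise angle (a minimum over a finite set, nonempty when `n ≥ 2`). -/
def angleMin {n p : ℕ} (x : Fin n → UnitSphere p) : ℝ := ⨅ q : PairIdx n, pairAngle x q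

/-- The largest pairwise angle (a maximum over a finite set, nonempty when `n ≥ 2`). -/
def angleMax {n p : ℕ} (x : Fin n → UnitSphere p) : ℝ := ⨆ q : PairIdx n, pairAngle x q

/-- The largest deviation of a pairwise angle from `π / 2`. -/
def angleMaxDev {n p : ℕ} (x : Fin n → UnitSphere p) : ℝ :=
  ⨆ q : PairIdx n, |pairAngle x q - Real.pi / 2|

end

/-! The number of pairs of points lying unusually close together is asymptotically Poisson, and the
distribution function of an extreme angle is the probability that this number is positive.

Fix a sign `σ` (`1` for the smallest angle, `-1` for the largest) and a threshold `t`, and consider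
for each pair the event that `σ` times its inner product is at least `t`. Given one endpoint, this
event has a probability `b` that does not depend on that endpoint. Hence events of pairs sharing one
index are independent, as are those of disjoint pairs, although the whole family is not. The general
Poisson bound `abs_measureReal_void_sub_exp_le` then gives `exp (-n(n-1)b/2)` for the probability
that no event occurs, with error at most `8n³b²`, which is `O(1/n)` when `n²b` converges. That bound
is obtained by integrating an approximate differential equation for the generating function of the
count.

To find `b`, describe a point by its slope `u = cot θ` over the axis; its density is proportional to
`(1 + u²)^(-p/2)` (`toSphere_inner_preimage`). Its total mass is asymptotic to `√(2π/p)`, and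
Mills-type bounds enclose its tail. With `1 + c² = exp ((4 log n - log log n - y)/p)`, the tail
beyond `c` times `n²` tends to `e^(y/2) / (2√(2π))` (`tendsto_sq_mul_slopeTail`); there are about
`n²/2` pairs, whence `K`.

Since `sin⁻² θ = 1 + cot² θ`, the rescaled logarithm is at most `y` exactly when `|cos θ|` reaches
the threshold, outside the null event `sin θ = 0`. For the smallest angle the negative alternative
would put every pair, hence any fixed pair, into the opposite cap, which has vanishing probability;
the largest angle is symmetric. Concentration at `π/2` is a union bound over caps of fixed slope,
whose tails are eventually below those at every level `y`. -/

section PoissonApproximation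

/-! ### Poisson approximation for locally dependent events -/

variable {Ω ι : Type*}

/-- The number of indices in `s` whose event contains `ω`. -/
noncomputable def occurrences (A : ι → Set Ω) (s : Finset ι) (ω : Ω) : ℕ :=
  ∑ i ∈ s, (A i).indicator (fun _ => 1) ω

lemma occurrences_cast (A : ι → Set Ω) (s : Finset ι) (ω : Ω) :
    (occurrences A s ω : ℝ) = ∑ i ∈ s, (A i).indicator (fun _ => (1 : ℝ)) ω := by
  rw [occurrences, Nat.cast_sum]
  refine Finset.sum_congr rfl fun i _ => ?_
  by_cases h : ω ∈ A i <;> simp [h]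

lemma occurrences_le (A : ι → Set Ω) (s : Finset ι) (ω : Ω) : occurrences A s ω ≤ s.card := by
  rw [occurrences, Finset.card_eq_sum_ones]
  refine Finset.sum_le_sum fun i _ => ?_
  by_cases h : ω ∈ A i <;> simp [h]

lemma occurrences_union [DecidableEq ι] (A : ι → Set Ω) {s t : Finset ι} (h : Disjoint s t)
    (ω : Ω) : occurrences A (s ∪ t) ω = occurrences A s ω + occurrences A t ω :=
  Finset.sum_union h

lemma occurrences_eq_zero {A : ι → Set Ω} {s : Finset ι} {ω : Ω} :
    occurrences A s ω = 0 ↔ ∀ i ∈ s, ω ∉ A i := by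
  rw [occurrences, Finset.sum_eq_zero_iff]
  simp

variable [MeasurableSpace Ω]

lemma measurable_occurrences {A : ι → Set Ω} (hA : ∀ i, MeasurableSet (A i)) (s : Finset ι) :
    Measurable (occurrences A s) := by
  have : occurrences A s = fun ω => ∑ i ∈ s, (A i).indicator (fun _ => (1 : ℕ)) ω := rfl
  rw [this]
  exact Finset.measurable_sum _ fun i _ => measurable_const.indicator (hA i)

lemma abs_pow_add_sub_pow_le {r : ℝ} (h0 : 0 ≤ r) (h1 : r ≤ 1) (v z : ℕ) :
    |r ^ (v + z) - r ^ v| ≤ z := by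
  have hv : r ^ v ≤ 1 := pow_le_one₀ h0 h1
  have hv0 : 0 ≤ r ^ v := pow_nonneg h0 v
  have hz : r ^ z ≤ 1 := pow_le_one₀ h0 h1
  have hz0 : 0 ≤ r ^ z := pow_nonneg h0 z
  rcases Nat.eq_zero_or_pos z with rfl | hz1
  · simp
  · have : (1 : ℝ) ≤ z := by exact_mod_cast hz1
    rw [pow_add, abs_le]
    constructor <;> nlinarith

variable {μ : Measure Ω} [IsProbabilityMeasure μ]

lemma integrable_pow_occurrences {A : ι → Set Ω} (hA : ∀ i, MeasurableSet (A i)) (s : Finset ι)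
    {r : ℝ} (h0 : 0 ≤ r) (h1 : r ≤ 1) : Integrable (fun ω => r ^ occurrences A s ω) μ := by
  refine Integrable.of_bound (C := 1) ?_ (ae_of_all _ fun ω => ?_)
  · exact ((measurable_from_nat (f := fun k => r ^ k)).comp
      (measurable_occurrences hA s)).aestronglyMeasurable
  · rw [Real.norm_of_nonneg (pow_nonneg h0 _)]
    exact pow_le_one₀ h0 h1

/-- The count is bounded by `s.card`, so near `x` the differentiated integrand has a constant bound.
The truncated exponent is harmless because its factor vanishes when the count is zero. -/
lemma hasDerivAt_integral_pow_occurrences {A : ι → Set Ω} (hA : ∀ i, MeasurableSet (A i))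
    (s : Finset ι) (x : ℝ) :
    HasDerivAt (fun x : ℝ => ∫ ω, (1 - x) ^ occurrences A s ω ∂μ)
      (∫ ω, -((occurrences A s ω : ℝ) * (1 - x) ^ (occurrences A s ω - 1)) ∂μ) x := by
  have hm : ∀ f : ℕ → ℝ, AEStronglyMeasurable (fun ω => f (occurrences A s ω)) μ := fun f =>
    ((measurable_from_nat (f := f)).comp (measurable_occurrences hA s)).aestronglyMeasurable
  refine (hasDerivAt_integral_of_dominated_loc_of_deriv_le (μ := μ)
    (F := fun (x : ℝ) ω => (1 - x) ^ occurrences A s ω)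
    (F' := fun (x : ℝ) ω => -((occurrences A s ω : ℝ) * (1 - x) ^ (occurrences A s ω - 1)))
    (s := Metric.ball x 1) (bound := fun _ => (s.card : ℝ) * (2 + |x|) ^ s.card)
    (Metric.ball_mem_nhds x one_pos) ?_ ?_ ?_ ?_ ?_ ?_).2
  · exact Eventually.of_forall fun y => hm fun k => (1 - y) ^ k
  · refine Integrable.of_bound (C := (2 + |x|) ^ s.card) (hm fun k => (1 - x) ^ k)
      (ae_of_all _ fun ω => ?_)
    rw [norm_pow]
    have : ‖1 - x‖ ≤ 2 + |x| := by
      rw [Real.norm_eq_abs, abs_le]; constructor <;> linarith [neg_abs_le x, le_abs_self x]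
    calc ‖1 - x‖ ^ occurrences A s ω ≤ (2 + |x|) ^ occurrences A s ω := by gcongr
      _ ≤ _ := pow_le_pow_right₀ (by linarith [abs_nonneg x]) (occurrences_le A s ω)
  · exact hm fun k => -((k : ℝ) * (1 - x) ^ (k - 1))
  · refine ae_of_all _ fun ω y hy => ?_
    rw [Metric.mem_ball, Real.dist_eq, abs_lt] at hy
    have : ‖1 - y‖ ≤ 2 + |x| := by
      rw [Real.norm_eq_abs, abs_le]; constructor <;> linarith [neg_abs_le x, le_abs_self x]
    rw [norm_neg, norm_mul, norm_pow, Real.norm_natCast]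
    have h1 : (occurrences A s ω : ℝ) ≤ s.card := by exact_mod_cast occurrences_le A s ω
    gcongr
    calc ‖1 - y‖ ^ (occurrences A s ω - 1) ≤ (2 + |x|) ^ (occurrences A s ω - 1) := by gcongr
      _ ≤ _ := pow_le_pow_right₀ (by linarith [abs_nonneg x])
          ((Nat.sub_le _ _).trans (occurrences_le A s ω))
  · exact integrable_const _
  · refine ae_of_all _ fun ω y _ => ?_
    have := ((hasDerivAt_id y).const_sub 1).pow (occurrences A s ω)
    exact this.congr_deriv (by simp)

lemma integral_occurrences {A : ι → Set Ω} (hA : ∀ i, MeasurableSet (A i)) (s : Finset ι) :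
    ∫ ω, (occurrences A s ω : ℝ) ∂μ = ∑ i ∈ s, μ.real (A i) := by
  simp_rw [occurrences_cast]
  rw [integral_finsetSum _ fun i _ => (integrable_const _).indicator (hA i)]
  refine Finset.sum_congr rfl fun i _ => ?_
  rw [integral_indicator (hA i)]
  simp

lemma integrable_occurrences {A : ι → Set Ω} (hA : ∀ i, MeasurableSet (A i)) (s : Finset ι) :
    Integrable (fun ω => (occurrences A s ω : ℝ)) μ := by
  simp_rw [occurrences_cast]
  exact integrable_finsetSum _ fun i _ => (integrable_const _).indicator (hA i)

/-- The local error in the Poisson approximation, for one index `i`. -/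
lemma abs_integral_indicator_pow_sub_le [Fintype ι] [DecidableEq ι] {A : ι → Set Ω}
    (hA : ∀ i, MeasurableSet (A i)) (i : ι) (N : Finset ι) (hi : i ∈ N)
    (hind : IndepFun ((A i).indicator fun _ => (1 : ℝ)) (occurrences A Nᶜ) μ)
    {r : ℝ} (h0 : 0 ≤ r) (h1 : r ≤ 1) :
    |∫ ω, (A i).indicator (fun _ => (1 : ℝ)) ω * r ^ (occurrences A Finset.univ ω - 1) ∂μ
      - μ.real (A i) * ∫ ω, r ^ occurrences A Finset.univ ω ∂μ|
      ≤ (∑ j ∈ N.erase i, μ.real (A i ∩ A j)) + μ.real (A i) * ∑ j ∈ N, μ.real (A j) := by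
  set I : Ω → ℝ := (A i).indicator fun _ => (1 : ℝ) with hI
  have hI01 : ∀ ω, I ω = 0 ∨ I ω = 1 := fun ω => by
    by_cases h : ω ∈ A i <;> simp [hI, h]
  have hIm : Measurable I := measurable_const.indicator (hA i)
  have hIint : ∫ ω, I ω ∂μ = μ.real (A i) := by
    rw [hI, integral_indicator (hA i)]; simp
  have key : ∫ ω, I ω * r ^ occurrences A Nᶜ ω ∂μ
      = μ.real (A i) * ∫ ω, r ^ occurrences A Nᶜ ω ∂μ := by
    have h2 : IndepFun I (fun ω => r ^ occurrences A Nᶜ ω) μ :=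
      hind.comp measurable_id (measurable_from_nat (f := fun k => r ^ k))
    rw [h2.integral_fun_mul_eq_mul_integral hIm.aestronglyMeasurable
      (integrable_pow_occurrences hA _ h0 h1).aestronglyMeasurable, hIint]
  have hdecomp : ∀ ω, occurrences A Finset.univ ω
      = occurrences A Nᶜ ω + occurrences A N ω := fun ω => by
    rw [← occurrences_union A disjoint_compl_left]
    rw [Finset.union_comm, Finset.union_compl]
  have hN : ∀ ω, (occurrences A N ω : ℝ) = I ω + occurrences A (N.erase i) ω := fun ω => by
    rw [occurrences_cast, occurrences_cast, ← Finset.add_sum_erase N _ hi]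
  have hb : ∀ {f : Ω → ℝ}, Integrable f μ → Integrable (fun ω => I ω * f ω) μ := fun hf => by
    refine hf.mono (hIm.aestronglyMeasurable.mul hf.aestronglyMeasurable)
      (ae_of_all _ fun ω => ?_)
    rcases hI01 ω with h | h <;> simp [h]
  have hmeas1 : AEStronglyMeasurable (fun ω => r ^ (occurrences A Finset.univ ω - 1)) μ :=
    ((measurable_from_nat (f := fun k => r ^ (k - 1))).comp
      (measurable_occurrences hA Finset.univ)).aestronglyMeasurable
  have hint1 : Integrable (fun ω => r ^ (occurrences A Finset.univ ω - 1)) μ := by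
    refine Integrable.of_bound (C := 1) hmeas1 (ae_of_all _ fun ω => ?_)
    rw [Real.norm_of_nonneg (pow_nonneg h0 _)]
    exact pow_le_one₀ h0 h1
  have hV := integrable_pow_occurrences (μ := μ) hA Nᶜ h0 h1
  have hW := integrable_pow_occurrences (μ := μ) hA Finset.univ h0 h1
  -- On `A i` the count minus one is the count over `Nᶜ` plus that over `N.erase i`; dropping the
  -- latter changes the power by at most its value.
  have e1 : |∫ ω, I ω * r ^ (occurrences A Finset.univ ω - 1) ∂μ
      - ∫ ω, I ω * r ^ occurrences A Nᶜ ω ∂μ| ≤ ∑ j ∈ N.erase i, μ.real (A i ∩ A j) := by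
    rw [← integral_sub (hb hint1) (hb hV)]
    have : ∑ j ∈ N.erase i, μ.real (A i ∩ A j)
        = ∫ ω, I ω * (occurrences A (N.erase i) ω : ℝ) ∂μ := by
      simp_rw [occurrences_cast, Finset.mul_sum]
      rw [integral_finsetSum _ fun j _ => hb ((integrable_const _).indicator (hA j))]
      refine Finset.sum_congr rfl fun j _ => ?_
      have : ∀ ω, I ω * (A j).indicator (fun _ => (1 : ℝ)) ω
          = (A i ∩ A j).indicator (fun _ => (1 : ℝ)) ω := fun ω => by
        by_cases h : ω ∈ A i <;> by_cases h' : ω ∈ A j <;> simp [hI, h, h']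
      simp_rw [this]
      rw [integral_indicator ((hA i).inter (hA j))]
      simp
    rw [this]
    refine (abs_integral_le_integral_abs).trans
      (integral_mono ((hb hint1).sub (hb hV)).abs (hb (integrable_occurrences hA _)) fun ω => ?_)
    rcases hI01 ω with h | h
    · simp [h]
    · have h3 : occurrences A N ω = 1 + occurrences A (N.erase i) ω := by
        have := hN ω
        rw [h] at this
        exact_mod_cast this
      have h4 : occurrences A Finset.univ ω - 1
          = occurrences A Nᶜ ω + occurrences A (N.erase i) ω := by
        rw [hdecomp, h3]; omega
      simp only [h, one_mul, h4]
      exact abs_pow_add_sub_pow_le h0 h1 _ _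
  have e2 : |∫ ω, r ^ occurrences A Nᶜ ω ∂μ - ∫ ω, r ^ occurrences A Finset.univ ω ∂μ|
      ≤ ∑ j ∈ N, μ.real (A j) := by
    rw [← integral_sub hV hW, ← integral_occurrences hA N]
    refine (abs_integral_le_integral_abs).trans
      (integral_mono (hV.sub hW).abs (integrable_occurrences hA _) fun ω => ?_)
    simp only [hdecomp ω]
    rw [abs_sub_comm]
    exact abs_pow_add_sub_pow_le h0 h1 _ _
  rw [key] at e1
  have e3 : |μ.real (A i) * ∫ ω, r ^ occurrences A Nᶜ ω ∂μ
      - μ.real (A i) * ∫ ω, r ^ occurrences A Finset.univ ω ∂μ|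
      ≤ μ.real (A i) * ∑ j ∈ N, μ.real (A j) := by
    rw [← mul_sub, abs_mul, abs_of_nonneg measureReal_nonneg]
    gcongr
  exact (abs_sub_le _ _ _).trans (add_le_add e1 e3)

/-- **Poisson approximation** of the void probability of a dissociated family of events. -/
theorem abs_measureReal_void_sub_exp_le [Fintype ι] [DecidableEq ι] {A : ι → Set Ω}
    (hA : ∀ i, MeasurableSet (A i)) (N : ι → Finset ι) (hN : ∀ i, i ∈ N i)
    (hind : ∀ i, IndepFun ((A i).indicator fun _ => (1 : ℝ)) (occurrences A (N i)ᶜ) μ) :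
    |μ.real (⋃ i, A i)ᶜ - Real.exp (-∑ i, μ.real (A i))|
      ≤ ∑ i, ((∑ j ∈ (N i).erase i, μ.real (A i ∩ A j))
          + μ.real (A i) * ∑ j ∈ N i, μ.real (A j)) := by
  set l := ∑ i, μ.real (A i) with hl
  set ε := ∑ i, ((∑ j ∈ (N i).erase i, μ.real (A i ∩ A j))
          + μ.real (A i) * ∑ j ∈ N i, μ.real (A j)) with hε
  have hl0 : 0 ≤ l := Finset.sum_nonneg fun i _ => measureReal_nonneg
  set W := occurrences A Finset.univ with hW
  set q : ℝ → ℝ := fun s => ∫ ω, (1 - s) ^ W ω ∂μ with hq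
  set q' : ℝ → ℝ := fun s => ∫ ω, -((W ω : ℝ) * (1 - s) ^ (W ω - 1)) ∂μ with hq'
  have hder : ∀ s, HasDerivAt q (q' s) s := hasDerivAt_integral_pow_occurrences hA Finset.univ
  -- A Poisson count of mean `l` has `q s = exp (-l * s)`, so `q' + l * q = 0`; here the defect is
  -- the sum of the local errors.
  have hbound : ∀ s ∈ Set.Icc (0 : ℝ) 1, |q' s + l * q s| ≤ ε := by
    intro s hs
    have h0 : 0 ≤ 1 - s := by linarith [hs.2]
    have h1 : 1 - s ≤ 1 := by linarith [hs.1]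
    have hint1 : ∀ i, Integrable
        (fun ω => (A i).indicator (fun _ => (1 : ℝ)) ω * (1 - s) ^ (W ω - 1)) μ := fun i => by
      refine Integrable.of_bound (C := 1) ?_ (ae_of_all _ fun ω => ?_)
      · exact ((measurable_const.indicator (hA i)).mul
          ((measurable_from_nat (f := fun k => (1 - s) ^ (k - 1))).comp
          (measurable_occurrences hA Finset.univ))).aestronglyMeasurable
      · have := pow_le_one₀ h0 h1 (n := W ω - 1)
        have h3 := pow_nonneg h0 (W ω - 1)
        by_cases h : ω ∈ A i
        · simp only [Set.indicator_of_mem h, one_mul]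
          rwa [Real.norm_of_nonneg h3]
        · simp [h]
    have e : q' s = -∑ i, ∫ ω, (A i).indicator (fun _ => (1 : ℝ)) ω * (1 - s) ^ (W ω - 1) ∂μ := by
      rw [← integral_finsetSum _ fun i _ => hint1 i, ← integral_neg]
      simp only [hq', ← Finset.sum_mul, ← occurrences_cast, hW]
    rw [e, hl, Finset.sum_mul, ← abs_neg, neg_add, neg_neg, ← sub_eq_add_neg,
      ← Finset.sum_sub_distrib]
    refine (Finset.abs_sum_le_sum_abs _ _).trans (Finset.sum_le_sum fun i _ => ?_)
    exact abs_integral_indicator_pow_sub_le hA i (N i) (hN i) (hind i) h0 h1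
  -- The integrating factor turns the defect into a derivative bound on `[0, 1]`, and `q 1` is the
  -- void probability since `0 ^ W` is the indicator of `W = 0`.
  have hder2 : ∀ s ∈ Set.Icc (0 : ℝ) 1, HasDerivWithinAt (fun s => Real.exp (l * s) * q s)
      (Real.exp (l * s) * (q' s + l * q s)) (Set.Icc 0 1) s := fun s _ => by
    have h1 : HasDerivAt (fun s => Real.exp (l * s)) (Real.exp (l * s) * (l * 1)) s :=
      ((hasDerivAt_id s).const_mul l).exp
    have := (h1.mul (hder s)).hasDerivWithinAt (s := Set.Icc 0 1)
    exact this.congr_deriv (by simp; ring)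
  have hmv := Convex.norm_image_sub_le_of_norm_hasDerivWithin_le (C := Real.exp l * ε) hder2
    (fun s hs => by
      rw [norm_mul, Real.norm_eq_abs, Real.norm_eq_abs, abs_of_pos (Real.exp_pos _)]
      have := hbound s hs
      have h2 : Real.exp (l * s) ≤ Real.exp l := Real.exp_le_exp.2 (by nlinarith [hs.2])
      gcongr)
    (convex_Icc 0 1) (Set.left_mem_Icc.2 zero_le_one) (Set.right_mem_Icc.2 zero_le_one)
  have hq0 : q 0 = 1 := by simp [hq]
  have hq1 : q 1 = μ.real (⋃ i, A i)ᶜ := by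
    have : ∀ ω, (1 - 1 : ℝ) ^ W ω = (⋃ i, A i)ᶜ.indicator (fun _ => (1 : ℝ)) ω := fun ω => by
      by_cases h : ω ∈ ⋃ i, A i
      · have : W ω ≠ 0 := fun h0 => by
          obtain ⟨i, hi⟩ := Set.mem_iUnion.1 h
          exact occurrences_eq_zero.1 h0 i (Finset.mem_univ i) hi
        rw [Set.indicator_of_notMem (Set.notMem_compl_iff.2 h), sub_self, zero_pow this]
      · have : W ω = 0 := occurrences_eq_zero.2 fun i _ hi => h (Set.mem_iUnion.2 ⟨i, hi⟩)
        rw [Set.indicator_of_mem (by exact h), this, pow_zero]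
    simp only [hq, this]
    rw [integral_indicator (MeasurableSet.iUnion hA).compl]
    simp
  simp only [mul_one, mul_zero, Real.exp_zero, hq0, hq1, sub_zero, norm_one] at hmv
  rw [Real.norm_eq_abs] at hmv
  have h5 : Real.exp l * μ.real (⋃ i, A i)ᶜ - 1
      = Real.exp l * (μ.real (⋃ i, A i)ᶜ - Real.exp (-l)) := by
    rw [mul_sub, ← Real.exp_add]; simp
  rw [h5, abs_mul, abs_of_pos (Real.exp_pos _)] at hmv
  exact le_of_mul_le_mul_left hmv (Real.exp_pos _)

end PoissonApproximation

/-! ### Weak convergence and the limit law -/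

/-- Pointwise convergence of the distribution functions to that of a law without atoms gives weak
convergence. -/
lemma tendsto_probabilityMeasure_of_tendsto_Iic {ι : Type*} {l : Filter ι}
    [l.IsCountablyGenerated] {μ : ι → ProbabilityMeasure ℝ} {ν : ProbabilityMeasure ℝ}
    (h : ∀ y, Tendsto (fun i => (μ i : Measure ℝ).real (Set.Iic y)) l
      (𝓝 ((ν : Measure ℝ).real (Set.Iic y)))) :
    Tendsto μ l (𝓝 ν) := by
  refine IsPiSystem.tendsto_probabilityMeasure_of_tendsto_of_mem
    (S := {s | ∃ a b : ℝ, a < b ∧ Set.Ioc a b = s}) ?_ ?_ ?_ ?_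
  · rintro _ ⟨a, b, -, rfl⟩ _ ⟨c, d, -, rfl⟩ hne
    rw [Set.Ioc_inter_Ioc] at hne ⊢
    exact ⟨_, _, Set.nonempty_Ioc.1 hne, rfl⟩
  · rintro _ ⟨a, b, -, rfl⟩
    exact measurableSet_Ioc
  · intro u hu x hx
    obtain ⟨ε, hε, hball⟩ := Metric.isOpen_iff.1 hu x hx
    refine ⟨Set.Ioc (x - ε / 2) (x + ε / 2), ⟨_, _, by linarith, rfl⟩,
      Ioc_mem_nhds (by linarith) (by linarith), fun y hy => hball ?_⟩
    rw [Metric.mem_ball, Real.dist_eq, abs_lt]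
    constructor <;> linarith [hy.1, hy.2]
  · rintro _ ⟨a, b, hab, rfl⟩
    have key : ∀ κ : ProbabilityMeasure ℝ, ((κ (Set.Ioc a b) : NNReal) : ℝ)
        = (κ : Measure ℝ).real (Set.Iic b) - (κ : Measure ℝ).real (Set.Iic a) := fun κ => by
      rw [← Set.Iic_sdiff_Iic, ← measureReal_sdiff (Set.Iic_subset_Iic.2 hab.le) measurableSet_Iic]
      rfl
    rw [← NNReal.tendsto_coe]
    simp_rw [key]
    exact (h b).sub (h a)

/-- The distribution function `1 - exp (-K exp (y / 2))`. -/
noncomputable def extremeStieltjes (K : ℝ) (hK : 0 < K) : StieltjesFunction ℝ where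
  toFun y := 1 - Real.exp (-K * Real.exp (y / 2))
  mono' := fun x y hxy => by
    have : Real.exp (x / 2) ≤ Real.exp (y / 2) := Real.exp_le_exp.2 (by linarith)
    have : Real.exp (-K * Real.exp (y / 2)) ≤ Real.exp (-K * Real.exp (x / 2)) :=
      Real.exp_le_exp.2 (by nlinarith)
    exact sub_le_sub_left this 1
  right_continuous' := fun x => by
    apply Continuous.continuousWithinAt
    fun_prop

/-- There is a law with distribution function `1 - exp (-K exp (y / 2))`. -/
lemma exists_extreme_law {K : ℝ} (hK : 0 < K) :
    ∃ (ν : Measure ℝ) (_ : IsProbabilityMeasure ν),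
      ∀ y : ℝ, cdf ν y = 1 - Real.exp (-K * Real.exp (y / 2)) := by
  have hbot : Tendsto (extremeStieltjes K hK) atBot (𝓝 0) := by
    have h : Tendsto (fun y : ℝ => 1 - Real.exp (-K * Real.exp (y / 2))) atBot
        (𝓝 (1 - Real.exp (-K * 0))) :=
      ((Real.continuous_exp.tendsto _).comp ((Real.tendsto_exp_atBot.comp
        (tendsto_id.atBot_div_const two_pos)).const_mul _)).const_sub 1
    rw [mul_zero, Real.exp_zero, sub_self] at h
    exact h
  have htop : Tendsto (extremeStieltjes K hK) atTop (𝓝 1) := by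
    have h : Tendsto (fun y : ℝ => 1 - Real.exp (-K * Real.exp (y / 2))) atTop (𝓝 (1 - 0)) :=
      (Real.tendsto_exp_atBot.comp ((Real.tendsto_exp_atTop.comp
        (tendsto_id.atTop_div_const two_pos)).const_mul_atTop_of_neg
          (neg_neg_of_pos hK))).const_sub 1
    rw [sub_zero] at h
    exact h
  have hprob : IsProbabilityMeasure (extremeStieltjes K hK).measure :=
    (extremeStieltjes K hK).isProbabilityMeasure hbot htop
  refine ⟨_, hprob, fun y => ?_⟩
  rw [cdf_measure_stieltjesFunction _ hbot htop]
  rfl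

/-! ### The law of the angle to a fixed axis -/

section

open scoped Pointwise ENNReal

/-- The unnormalized density of the slope `⟪e, x⟫ / ‖x - ⟪e, x⟫ e‖` of a uniform point of the
unit sphere of `ℝ^p`. -/
noncomputable def slopeDensity (p : ℕ) (u : ℝ) : ℝ := (√(1 + u ^ 2) ^ p)⁻¹

lemma slopeDensity_pos (p : ℕ) (u : ℝ) : 0 < slopeDensity p u := by
  unfold slopeDensity; positivity

lemma continuous_slopeDensity (p : ℕ) : Continuous (slopeDensity p) := by
  unfold slopeDensity
  refine Continuous.inv₀ (by fun_prop) fun u => by positivity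

/-- The cosine of the angle to the axis, as a function of the slope. -/
noncomputable def slopeCos (u : ℝ) : ℝ := u / √(1 + u ^ 2)

lemma continuous_slopeCos : Continuous slopeCos := by
  unfold slopeCos
  refine Continuous.div (by fun_prop) (by fun_prop) fun u => by positivity

section Cone

variable {V : Type*} [NormedAddCommGroup V] [NormedSpace ℝ V] [MeasurableSpace V] [BorelSpace V]
  [FiniteDimensional ℝ V]

lemma lintegral_comp_smul_addHaar (μ : Measure V) [μ.IsAddHaarMeasure] {r : ℝ} (hr : 0 < r)
    {f : V → ℝ≥0∞} (hf : Measurable f) :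
    ∫⁻ z, f (r • z) ∂μ = ENNReal.ofReal (r ^ Module.finrank ℝ V)⁻¹ * ∫⁻ z, f z ∂μ := by
  rw [← lintegral_map (μ := μ) (g := fun z => r • z) hf (measurable_const_smul r),
    Measure.map_addHaar_smul μ hr.ne', lintegral_smul_measure, smul_eq_mul,
    abs_of_nonneg (by positivity)]

/-- The volume of the part of a cone in the unit ball of `ℝ × V`, the cone being given by the
set `B` of its slopes. -/
lemma volume_prod_cone (μ : Measure V) [μ.IsAddHaarMeasure] [Nontrivial V] {D : Set (ℝ × V)}
    (hD : MeasurableSet D) {B : Set ℝ} (hB : MeasurableSet B)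
    (h : ∀ z : V, z ≠ 0 → ∀ u : ℝ, (u * ‖z‖, z) ∈ D ↔ u ∈ B ∧ √(1 + u ^ 2) * ‖z‖ < 1) :
    (volume.prod μ) D =
      (∫⁻ u in B, ENNReal.ofReal (slopeDensity (Module.finrank ℝ V + 1) u)) *
        ∫⁻ z, ENNReal.ofReal ‖z‖ * (Metric.ball (0 : V) 1).indicator 1 z ∂μ := by
  set f : V → ℝ≥0∞ := fun z => ENNReal.ofReal ‖z‖ * (Metric.ball (0 : V) 1).indicator 1 z with hf
  have hfm : Measurable f := by
    refine Measurable.mul (by fun_prop) (measurable_one.indicator Metric.isOpen_ball.measurableSet)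
  -- Substitute `s = u * ‖z‖`. The Jacobian `‖z‖` is written as `(√(1 + u ^ 2))⁻¹` times the norm of
  -- the scaled vector, so that the integrand depends on `z` only through `f (√(1 + u ^ 2) • z)`.
  have hfibre : ∀ z : V, z ≠ 0 → volume ((fun s : ℝ => (s, z)) ⁻¹' D)
      = ∫⁻ u, B.indicator (fun u => ENNReal.ofReal (√(1 + u ^ 2))⁻¹ * f (√(1 + u ^ 2) • z)) u := by
    intro z hz
    have hz' : 0 < ‖z‖ := norm_pos_iff.2 hz
    have hmeas : MeasurableSet ((fun u : ℝ => (u * ‖z‖, z)) ⁻¹' D) :=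
      (by fun_prop : Measurable fun u : ℝ => (u * ‖z‖, z)) hD
    have h1 := Real.volume_preimage_mul_right hz'.ne' ((fun s : ℝ => (s, z)) ⁻¹' D)
    have h2 : volume ((fun s : ℝ => (s, z)) ⁻¹' D)
        = ENNReal.ofReal ‖z‖ * volume ((fun u : ℝ => (u * ‖z‖, z)) ⁻¹' D) := by
      have : (fun u : ℝ => (u * ‖z‖, z)) ⁻¹' D
          = (fun u : ℝ => u * ‖z‖) ⁻¹' ((fun s : ℝ => (s, z)) ⁻¹' D) := rfl
      rw [this, h1, ← mul_assoc, ← ENNReal.ofReal_mul hz'.le, abs_of_pos (inv_pos.2 hz'),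
        mul_inv_cancel₀ hz'.ne', ENNReal.ofReal_one, one_mul]
    rw [h2, ← lintegral_indicator_one hmeas, ← lintegral_const_mul' _ _ ENNReal.ofReal_ne_top]
    refine lintegral_congr fun u => ?_
    have hs : 0 < √(1 + u ^ 2) := by positivity
    by_cases hu : u ∈ B
    · rw [Set.indicator_of_mem hu]
      simp only [hf]
      have hn : ‖√(1 + u ^ 2) • z‖ = √(1 + u ^ 2) * ‖z‖ := by
        rw [norm_smul, Real.norm_of_nonneg hs.le]
      rw [← mul_assoc, ← ENNReal.ofReal_mul (by positivity), hn, inv_mul_cancel_left₀ hs.ne']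
      congr 1
      by_cases hb : √(1 + u ^ 2) * ‖z‖ < 1
      · rw [Set.indicator_of_mem (show u ∈ (fun u : ℝ => (u * ‖z‖, z)) ⁻¹' D from
          (h z hz u).2 ⟨hu, hb⟩), Set.indicator_of_mem]
        · rfl
        · rwa [mem_ball_zero_iff, hn]
      · rw [Set.indicator_of_notMem (show u ∉ (fun u : ℝ => (u * ‖z‖, z)) ⁻¹' D from
          fun h' => hb ((h z hz u).1 h').2),
           Set.indicator_of_notMem]
        rwa [mem_ball_zero_iff, hn]
    · rw [Set.indicator_of_notMem hu,
        Set.indicator_of_notMem (show u ∉ (fun u : ℝ => (u * ‖z‖, z)) ⁻¹' D from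
          fun h' => hu ((h z hz u).1 h').1),
        mul_zero]
  have hswap : Measurable (Function.uncurry fun (z : V) (u : ℝ) =>
      B.indicator (fun u => ENNReal.ofReal (√(1 + u ^ 2))⁻¹ * f (√(1 + u ^ 2) • z)) u) := by
    have : (Function.uncurry fun (z : V) (u : ℝ) =>
        B.indicator (fun u => ENNReal.ofReal (√(1 + u ^ 2))⁻¹ * f (√(1 + u ^ 2) • z)) u)
        = (Prod.snd ⁻¹' B).indicator fun q : V × ℝ =>
          ENNReal.ofReal (√(1 + q.2 ^ 2))⁻¹ * f (√(1 + q.2 ^ 2) • q.1) := by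
      ext ⟨z, u⟩
      by_cases hu : u ∈ B <;> simp [hu]
    rw [this]
    exact Measurable.indicator (Measurable.mul (by fun_prop) (hfm.comp (by fun_prop)))
      (measurable_snd hB)
  have hne : ∀ᵐ z ∂μ, z ≠ 0 := by
    rw [ae_iff]; simp
  rw [Measure.prod_apply_symm hD, lintegral_congr_ae (hne.mono hfibre),
    lintegral_lintegral_swap hswap.aemeasurable, ← lintegral_indicator hB,
    ← lintegral_mul_const _ (((continuous_slopeDensity _).measurable.ennreal_ofReal).indicator hB)]
  refine lintegral_congr fun u => ?_
  by_cases hu : u ∈ B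
  · simp only [Set.indicator_of_mem hu]
    have hs : 0 < √(1 + u ^ 2) := by positivity
    -- Undoing the scaling costs `finrank ℝ V` factors `√(1 + u ^ 2)`; the Jacobian supplies one
    -- more.
    rw [lintegral_const_mul' _ _ ENNReal.ofReal_ne_top,
      lintegral_comp_smul_addHaar μ hs hfm, ← mul_assoc, ← ENNReal.ofReal_mul (by positivity)]
    congr 2
    rw [slopeDensity, pow_succ _ (Module.finrank ℝ V), mul_inv, mul_comm]
  · simp [Set.indicator_of_notMem hu]

end Cone

/-- Orthogonal splitting of `ℝ^(m+1)` along a unit vector. -/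
lemma exists_measurePreserving_split {m : ℕ} (e : EuclideanSpace ℝ (Fin (m + 1))) (he : ‖e‖ = 1) :
    ∃ Φ : EuclideanSpace ℝ (Fin (m + 1)) ≃ᵐ ℝ × EuclideanSpace ℝ (Fin m),
      MeasurePreserving Φ volume (volume.prod volume) ∧
        ∀ y, (Φ y).1 = inner ℝ e y ∧ ‖y‖ ^ 2 = (Φ y).1 ^ 2 + ‖(Φ y).2‖ ^ 2 := by
  set e₀ : EuclideanSpace ℝ (Fin (m + 1)) := EuclideanSpace.single 0 1 with he₀
  have hn : ‖e‖ = ‖e₀‖ := by simp [he₀, he]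
  -- This reflection carries `e` to the first basis vector, so splitting along `e` becomes splitting
  -- off a coordinate.
  set U := (ℝ ∙ (e - e₀))ᗮ.reflection with hU
  have hUe : U e = e₀ := Submodule.reflection_sub hn
  set Ψ : EuclideanSpace ℝ (Fin (m + 1)) ≃ᵐ ℝ × EuclideanSpace ℝ (Fin m) :=
    ((MeasurableEquiv.toLp 2 (Fin (m + 1) → ℝ)).symm.trans
      (MeasurableEquiv.piFinSuccAbove (fun _ => ℝ) 0)).trans
      ((MeasurableEquiv.refl ℝ).prodCongr (MeasurableEquiv.toLp 2 (Fin m → ℝ))) with hΨ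
  have hΨm : MeasurePreserving Ψ volume (volume.prod volume) := by
    refine ((EuclideanSpace.volume_preserving_symm_measurableEquiv_toLp _).trans
      (volume_preserving_piFinSuccAbove (fun _ => ℝ) 0)).trans ?_
    exact (MeasurePreserving.id _).prod (PiLp.volume_preserving_toLp (Fin m))
  refine ⟨U.toHomeomorph.toMeasurableEquiv.trans Ψ, U.measurePreserving.trans hΨm, fun y => ?_⟩
  have h1 : ∀ w, (Ψ w).1 = w 0 := fun w => rfl
  have h2 : ∀ w i, (Ψ w).2 i = w (Fin.succ i) := fun w i => rfl
  have h3 : (U.toHomeomorph.toMeasurableEquiv.trans Ψ) y = Ψ (U y) := rfl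
  rw [h3]
  refine ⟨?_, ?_⟩
  · rw [h1, ← U.inner_map_map, hUe, he₀, EuclideanSpace.inner_single_left]
    simp
  · rw [← U.norm_map y, EuclideanSpace.real_norm_sq_eq, EuclideanSpace.real_norm_sq_eq,
      Fin.sum_univ_succ, h1]
    simp_rw [h2]

lemma measurableSet_inner_sphere {p : ℕ} (e : EuclideanSpace ℝ (Fin p)) {B : Set ℝ}
    (hB : MeasurableSet B) :
    MeasurableSet {x : UnitSphere p | inner ℝ e (x : EuclideanSpace ℝ (Fin p)) ∈ B} :=
  (by fun_prop : Measurable fun x : UnitSphere p =>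
    inner ℝ e (x : EuclideanSpace ℝ (Fin p))) hB

/-- The surface measure of a zone of the sphere, up to a factor that depends only on the
dimension. -/
lemma toSphere_inner_preimage {m : ℕ} (hm : 1 ≤ m) {e : EuclideanSpace ℝ (Fin (m + 1))}
    (he : ‖e‖ = 1) {B : Set ℝ} (hB : MeasurableSet B) :
    (volume : Measure (EuclideanSpace ℝ (Fin (m + 1)))).toSphere
        {x | inner ℝ e (x : EuclideanSpace ℝ (Fin (m + 1))) ∈ B} =
      (∫⁻ u in slopeCos ⁻¹' B, ENNReal.ofReal (slopeDensity (m + 1) u)) *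
        ((m + 1 : ℕ) * ∫⁻ z : EuclideanSpace ℝ (Fin m),
          ENNReal.ofReal ‖z‖ * (Metric.ball (0 : EuclideanSpace ℝ (Fin m)) 1).indicator 1 z) := by
  have : Nonempty (Fin m) := ⟨⟨0, hm⟩⟩
  obtain ⟨Φ, hΦ, hΦe⟩ := exists_measurePreserving_split e he
  have hcone : Set.Ioo (0 : ℝ) 1 • ((↑) '' {x : UnitSphere (m + 1) |
      inner ℝ e (x : EuclideanSpace ℝ (Fin (m + 1))) ∈ B})
      = {y : EuclideanSpace ℝ (Fin (m + 1)) | 0 < ‖y‖ ∧ ‖y‖ < 1 ∧ inner ℝ e y / ‖y‖ ∈ B} := by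
    ext y
    rw [Set.mem_smul]
    constructor
    · rintro ⟨r, hr, _, ⟨x, hx, rfl⟩, rfl⟩
      have hx1 : ‖(x : EuclideanSpace ℝ (Fin (m + 1)))‖ = 1 := norm_eq_of_mem_sphere x
      have hn : ‖r • (x : EuclideanSpace ℝ (Fin (m + 1)))‖ = r := by
        rw [norm_smul, hx1, mul_one, Real.norm_of_nonneg hr.1.le]
      refine ⟨by rw [hn]; exact hr.1, by rw [hn]; exact hr.2, ?_⟩
      rw [hn, real_inner_smul_right, mul_div_cancel_left₀ _ hr.1.ne']
      exact hx
    · rintro ⟨h0, h1, h2⟩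
      have hn : ‖y‖⁻¹ • y ∈ Metric.sphere (0 : EuclideanSpace ℝ (Fin (m + 1))) 1 := by
        rw [mem_sphere_zero_iff_norm, norm_smul, norm_inv, norm_norm, inv_mul_cancel₀ h0.ne']
      refine ⟨‖y‖, ⟨h0, h1⟩, ‖y‖⁻¹ • y, ⟨⟨_, hn⟩, ?_, rfl⟩, ?_⟩
      · change inner ℝ e (‖y‖⁻¹ • y) ∈ B
        rwa [real_inner_smul_right, mul_comm, ← div_eq_mul_inv]
      · rw [smul_smul, mul_inv_cancel₀ h0.ne', one_smul]
  have hconem : MeasurableSet {y : EuclideanSpace ℝ (Fin (m + 1)) |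
      0 < ‖y‖ ∧ ‖y‖ < 1 ∧ inner ℝ e y / ‖y‖ ∈ B} := by
    refine (measurableSet_lt measurable_const measurable_norm).inter
      ((measurableSet_lt measurable_norm measurable_const).inter ?_)
    exact (by fun_prop : Measurable fun y : EuclideanSpace ℝ (Fin (m + 1)) =>
      inner ℝ e y / ‖y‖) hB
  rw [Measure.toSphere_apply' _ (measurableSet_inner_sphere e hB), hcone, finrank_euclideanSpace_fin,
    ← (hΦ.symm Φ).measure_preimage hconem.nullMeasurableSet,
    volume_prod_cone volume (Φ.symm.measurable hconem) (continuous_slopeCos.measurable hB),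
    finrank_euclideanSpace_fin]
  · ring
  · intro z hz u
    have hz' : 0 < ‖z‖ := norm_pos_iff.2 hz
    have hs : 0 < √(1 + u ^ 2) := by positivity
    obtain ⟨h1, h2⟩ := hΦe (Φ.symm (u * ‖z‖, z))
    rw [Φ.apply_symm_apply] at h1 h2
    have hn : ‖Φ.symm (u * ‖z‖, z)‖ = √(1 + u ^ 2) * ‖z‖ := by
      rw [← sq_eq_sq₀ (norm_nonneg _) (by positivity), h2,
        mul_pow (√(1 + u ^ 2)), Real.sq_sqrt (by positivity)]
      ring
    simp only [Set.mem_preimage, Set.mem_ofPred_eq]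
    rw [hn, ← h1, mul_div_mul_right _ _ hz'.ne']
    exact ⟨fun h => ⟨h.2.2, h.2.1⟩, fun h => ⟨by positivity, h.2, h.1⟩⟩

lemma isProbabilityMeasure_uniformSphere {p : ℕ} (hp : 1 ≤ p) :
    IsProbabilityMeasure (uniformSphere p) := by
  have : Nonempty (Fin p) := ⟨⟨0, hp⟩⟩
  refine ⟨?_⟩
  rw [uniformSphere, Measure.smul_apply, smul_eq_mul, ENNReal.inv_mul_cancel]
  · rw [Ne, Measure.measure_univ_eq_zero]
    exact Measure.toSphere_ne_zero _
  · exact measure_ne_top _ _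

/-- The law of the cosine of the angle between a uniform point of the sphere and a fixed axis. -/
lemma uniformSphere_inner_preimage {p : ℕ} (hp : 2 ≤ p) {e : EuclideanSpace ℝ (Fin p)}
    (he : ‖e‖ = 1) {B : Set ℝ} (hB : MeasurableSet B) :
    uniformSphere p {x | inner ℝ e (x : EuclideanSpace ℝ (Fin p)) ∈ B} =
      (∫⁻ u in slopeCos ⁻¹' B, ENNReal.ofReal (slopeDensity p u)) /
        ∫⁻ u, ENNReal.ofReal (slopeDensity p u) := by
  obtain ⟨m, rfl⟩ : ∃ m, p = m + 1 := ⟨p - 1, by omega⟩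
  have hprob := isProbabilityMeasure_uniformSphere (p := m + 1) (by omega)
  have huniv := toSphere_inner_preimage (m := m) (by omega) he MeasurableSet.univ
  simp only [Set.mem_univ, Set.ofPred_true, Set.preimage_univ, Measure.restrict_univ] at huniv
  rw [uniformSphere, Measure.smul_apply, smul_eq_mul, toSphere_inner_preimage (by omega) he hB,
    huniv]
  have hfin : (volume : Measure (EuclideanSpace ℝ (Fin (m + 1)))).toSphere Set.univ ≠ ⊤ :=
    measure_ne_top _ _
  have hne : (volume : Measure (EuclideanSpace ℝ (Fin (m + 1)))).toSphere Set.univ ≠ 0 := by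
    rw [Ne, Measure.measure_univ_eq_zero]
    exact Measure.toSphere_ne_zero _
  rw [huniv] at hfin hne
  -- The dimensional factor cancels: the total mass is finite and nonzero, so this factor of it is
  -- too.
  rw [mul_comm, ← div_eq_mul_inv, ENNReal.mul_div_mul_right _ _ (right_ne_zero_of_mul hne)]
  intro h
  rw [h, ENNReal.mul_top (left_ne_zero_of_mul hne)] at hfin
  exact hfin rfl

end

/-! ### Mass and tail of the slope distribution -/

section

open scoped Pointwise ENNReal

lemma slopeDensity_eq_rpow (p : ℕ) (u : ℝ) :
    slopeDensity p u = (1 + u ^ 2) ^ (-(p : ℝ) / 2) := by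
  have h : (0 : ℝ) ≤ 1 + u ^ 2 := by positivity
  rw [slopeDensity, Real.sqrt_eq_rpow, ← Real.rpow_natCast, ← Real.rpow_mul h,
    ← Real.rpow_neg h]
  congr 1
  ring

lemma integrable_slopeDensity {p : ℕ} (hp : 2 ≤ p) : Integrable (slopeDensity p) := by
  refine integrable_inv_one_add_sq.mono (continuous_slopeDensity p).aestronglyMeasurable
    (ae_of_all _ fun u => ?_)
  have h : (1 : ℝ) ≤ √(1 + u ^ 2) := by
    rw [Real.one_le_sqrt]; nlinarith [sq_nonneg u]
  rw [Real.norm_of_nonneg (slopeDensity_pos p u).le, Real.norm_of_nonneg (by positivity),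
    slopeDensity]
  refine inv_anti₀ (by positivity) ?_
  calc 1 + u ^ 2 = √(1 + u ^ 2) ^ 2 := (Real.sq_sqrt (by positivity)).symm
    _ ≤ _ := pow_le_pow_right₀ h hp

/-- The normalizing constant of `slopeDensity`. -/
noncomputable def slopeMass (p : ℕ) : ℝ := ∫ u, slopeDensity p u

lemma slopeMass_pos {p : ℕ} (hp : 2 ≤ p) : 0 < slopeMass p := by
  refine (integral_pos_iff_support_of_nonneg (fun u => (slopeDensity_pos p u).le)
    (integrable_slopeDensity hp)).2 ?_
  have : Function.support (slopeDensity p) = Set.univ :=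
    Set.eq_univ_of_forall fun u => (slopeDensity_pos p u).ne'
  simp [this]

/-- The tail of the slope distribution. -/
noncomputable def slopeTail (p : ℕ) (c : ℝ) : ℝ :=
  (∫ u in Set.Ici c, slopeDensity p u) / slopeMass p

lemma slopeTail_nonneg (p : ℕ) (c : ℝ) : 0 ≤ slopeTail p c :=
  div_nonneg (setIntegral_nonneg measurableSet_Ici fun u _ => (slopeDensity_pos p u).le)
    (integral_nonneg fun u => (slopeDensity_pos p u).le)

lemma slopeTail_anti {p : ℕ} (hp : 2 ≤ p) {c d : ℝ} (h : c ≤ d) :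
    slopeTail p d ≤ slopeTail p c := by
  refine div_le_div_of_nonneg_right ?_ (slopeMass_pos hp).le
  exact setIntegral_mono_set (integrable_slopeDensity hp).integrableOn
    (ae_of_all _ fun u => (slopeDensity_pos p u).le) (Set.Ici_subset_Ici.2 h).eventuallyLE

lemma uniformSphere_real_inner_preimage {p : ℕ} (hp : 2 ≤ p) {e : EuclideanSpace ℝ (Fin p)}
    (he : ‖e‖ = 1) {B : Set ℝ} (hB : MeasurableSet B) :
    (uniformSphere p).real {x | inner ℝ e (x : EuclideanSpace ℝ (Fin p)) ∈ B} =
      (∫ u in slopeCos ⁻¹' B, slopeDensity p u) / slopeMass p := by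
  rw [measureReal_def, uniformSphere_inner_preimage hp he hB, ENNReal.toReal_div, slopeMass,
    integral_eq_lintegral_of_nonneg_ae (ae_of_all _ fun u => (slopeDensity_pos p u).le)
      (continuous_slopeDensity p).aestronglyMeasurable,
    integral_eq_lintegral_of_nonneg_ae (ae_of_all _ fun u => (slopeDensity_pos p u).le)
      (continuous_slopeDensity p).aestronglyMeasurable]

lemma slopeCos_strictMono : StrictMono slopeCos := by
  have key : ∀ u v : ℝ, u < v → u * √(1 + v ^ 2) < v * √(1 + u ^ 2) := by
    intro u v h
    have hu : (0 : ℝ) < √(1 + u ^ 2) := by positivity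
    have hv : (0 : ℝ) < √(1 + v ^ 2) := by positivity
    rcases le_or_gt 0 u with h0 | h0
    · refine lt_of_pow_lt_pow_left₀ 2 (by nlinarith) ?_
      rw [mul_pow, mul_pow, Real.sq_sqrt (by positivity), Real.sq_sqrt (by positivity)]
      nlinarith
    · rcases le_or_gt 0 v with h1 | h1
      · nlinarith
      · have : (-v) * √(1 + u ^ 2) < (-u) * √(1 + v ^ 2) := by
          refine lt_of_pow_lt_pow_left₀ 2 (by nlinarith) ?_
          rw [mul_pow, mul_pow, Real.sq_sqrt (by positivity), Real.sq_sqrt (by positivity)]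
          nlinarith
        linarith
  intro u v h
  rw [slopeCos, slopeCos, div_lt_div_iff₀ (by positivity) (by positivity)]
  exact key u v h

lemma slopeCos_lt_one (u : ℝ) : slopeCos u < 1 := by
  rw [slopeCos, div_lt_one (by positivity)]
  exact Real.lt_sqrt_of_sq_lt (by linarith)

/-- The measure of a spherical cap. -/
lemma uniformSphere_real_cap {p : ℕ} (hp : 2 ≤ p) {e : EuclideanSpace ℝ (Fin p)}
    (he : ‖e‖ = 1) (c : ℝ) :
    (uniformSphere p).real {x | slopeCos c ≤ inner ℝ e (x : EuclideanSpace ℝ (Fin p))} =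
      slopeTail p c := by
  have := uniformSphere_real_inner_preimage hp he (B := Set.Ici (slopeCos c)) measurableSet_Ici
  have h2 : slopeCos ⁻¹' Set.Ici (slopeCos c) = Set.Ici c := by
    ext u; exact slopeCos_strictMono.le_iff_le
  rw [h2] at this
  exact this

/-- `slopeCos` never attains `1`. This discards the angle at which `log sin` takes its default
value. -/
lemma uniformSphere_real_pole {p : ℕ} (hp : 2 ≤ p) {e : EuclideanSpace ℝ (Fin p)}
    (he : ‖e‖ = 1) :
    (uniformSphere p).real {x | inner ℝ e (x : EuclideanSpace ℝ (Fin p)) = 1} = 0 := by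
  have := uniformSphere_real_inner_preimage hp he (B := {1}) (measurableSet_singleton _)
  have h2 : slopeCos ⁻¹' {1} = ∅ := by
    ext u; simpa using (slopeCos_lt_one u).ne
  rw [h2] at this
  simpa using this

/-- With `u = v / √p` the density tends to `exp (-v² / 2)`. For `p ≥ 2`, Bernoulli's inequality
gives `(1 + v²/p)^(p/2) ≥ 1 + v²/2`, hence an integrable majorant. -/
lemma tendsto_sqrt_mul_slopeMass :
    Tendsto (fun p : ℕ => √(p : ℝ) * slopeMass p) atTop (𝓝 √(2 * Real.pi)) := by
  have h1 : ∀ᶠ p : ℕ in atTop,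
      ∫ v, slopeDensity p (v / √(p : ℝ)) = √(p : ℝ) * slopeMass p := by
    filter_upwards with p
    rw [Measure.integral_comp_div, abs_of_nonneg (Real.sqrt_nonneg _), smul_eq_mul, slopeMass]
  have h2 : ∫ v : ℝ, Real.exp (-(1 / 2) * v ^ 2) = √(2 * Real.pi) := by
    rw [integral_gaussian]; congr 1; ring
  rw [← h2]
  refine Tendsto.congr' h1 ?_
  refine tendsto_integral_filter_of_dominated_convergence (fun v => (1 + (v / √2) ^ 2)⁻¹)
    ?_ ?_ ?_ ?_
  · filter_upwards with p
    exact ((continuous_slopeDensity p).comp (by fun_prop)).aestronglyMeasurable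
  · filter_upwards [eventually_ge_atTop 2] with p hp
    refine ae_of_all _ fun v => ?_
    have hp0 : (0 : ℝ) < p := by positivity
    have hp2 : (2 : ℝ) ≤ p := by exact_mod_cast hp
    rw [Real.norm_of_nonneg (slopeDensity_pos _ _).le, slopeDensity_eq_rpow, neg_div,
      Real.rpow_neg (by positivity)]
    refine inv_anti₀ (by positivity) ?_
    rw [div_pow, div_pow, Real.sq_sqrt hp0.le, Real.sq_sqrt zero_le_two]
    have := one_add_mul_self_le_rpow_one_add (s := v ^ 2 / p) (p := (p : ℝ) / 2)
      (by linarith [show 0 ≤ v ^ 2 / p by positivity]) (by linarith)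
    calc 1 + v ^ 2 / 2 = 1 + (p : ℝ) / 2 * (v ^ 2 / p) := by field_simp
      _ ≤ _ := this
  · exact integrable_inv_one_add_sq.comp_div (by positivity)
  · refine ae_of_all _ fun v => ?_
    have h3 := Real.tendsto_one_add_div_pow_exp (v ^ 2)
    have h4 : Tendsto (fun p : ℕ => (√((1 + v ^ 2 / p) ^ p))⁻¹) atTop
        (𝓝 (√(Real.exp (v ^ 2)))⁻¹) :=
      ((Real.continuous_sqrt.tendsto _).comp h3).inv₀ (by positivity)
    have h5 : (√(Real.exp (v ^ 2)))⁻¹ = Real.exp (-(1 / 2) * v ^ 2) := by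
      rw [← Real.exp_half, ← Real.exp_neg]; congr 1; ring
    rw [h5] at h4
    refine h4.congr fun p => ?_
    have hp0 : (0 : ℝ) ≤ p := by positivity
    rw [slopeDensity, div_pow, Real.sq_sqrt hp0]
    congr 1
    rw [Real.sqrt_eq_iff_mul_self_eq (by positivity) (by positivity), ← mul_pow,
      Real.mul_self_sqrt (by positivity)]

lemma hasDerivAt_one_add_sq_rpow (a u : ℝ) :
    HasDerivAt (fun u : ℝ => (1 + u ^ 2) ^ a) (2 * u * a * (1 + u ^ 2) ^ (a - 1)) u := by
  have h : HasDerivAt (fun u : ℝ => 1 + u ^ 2) (2 * u) u := by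
    simpa using (hasDerivAt_pow 2 u).const_add 1
  exact h.rpow_const (Or.inl (by positivity))

lemma tendsto_one_add_sq_rpow {p : ℕ} (hp : 3 ≤ p) :
    Tendsto (fun u : ℝ => (1 + u ^ 2) ^ (1 - (p : ℝ) / 2)) atTop (𝓝 0) := by
  have hp' : (3 : ℝ) ≤ p := by exact_mod_cast hp
  have h := tendsto_rpow_neg_atTop (y := (p : ℝ) / 2 - 1) (by linarith)
  rw [neg_sub] at h
  exact h.comp (tendsto_atTop_add_const_left _ _ (tendsto_pow_atTop two_ne_zero))

/-- Upper bound for the tail of the slope distribution (Mills ratio). -/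
lemma integral_slopeDensity_le {p : ℕ} (hp : 3 ≤ p) {c : ℝ} (hc : 0 < c) :
    ∫ u in Set.Ici c, slopeDensity p u ≤ (1 + c ^ 2) ^ (1 - (p : ℝ) / 2) / (c * (p - 2)) := by
  have hp' : (3 : ℝ) ≤ p := by exact_mod_cast hp
  -- The density times `u` has an explicit primitive, and `u ≥ c` on the tail.
  have hd : ∀ u ∈ Set.Ici c, HasDerivAt (fun u : ℝ => -((1 + u ^ 2) ^ (1 - (p : ℝ) / 2) / (p - 2)))
      (u * slopeDensity p u) u := fun u _ => by
    refine ((hasDerivAt_one_add_sq_rpow (1 - (p : ℝ) / 2) u).div_const _).neg.congr_deriv ?_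
    rw [slopeDensity_eq_rpow, show 1 - (p : ℝ) / 2 - 1 = -(p : ℝ) / 2 by ring]
    have : (p : ℝ) - 2 ≠ 0 := by linarith
    field_simp
    ring
  have hpos : ∀ u ∈ Set.Ioi c, 0 ≤ u * slopeDensity p u := fun u hu =>
    mul_nonneg (hc.le.trans (le_of_lt hu)) (slopeDensity_pos p u).le
  have hlim : Tendsto (fun u : ℝ => -((1 + u ^ 2) ^ (1 - (p : ℝ) / 2) / ((p : ℝ) - 2))) atTop
      (𝓝 (-(0 / ((p : ℝ) - 2)))) := ((tendsto_one_add_sq_rpow hp).div_const _).neg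
  have hint := integrableOn_Ioi_deriv_of_nonneg' hd hpos hlim
  have hval := integral_Ioi_of_hasDerivAt_of_nonneg' hd hpos hlim
  rw [zero_div, neg_zero, zero_sub, neg_neg] at hval
  have hle : ∫ u in Set.Ioi c, c * slopeDensity p u ≤ ∫ u in Set.Ioi c, u * slopeDensity p u :=
    setIntegral_mono_on ((integrable_slopeDensity (by omega)).integrableOn.const_mul c) hint
      measurableSet_Ioi fun u hu => mul_le_mul_of_nonneg_right (le_of_lt hu)
        (slopeDensity_pos p u).le
  rw [integral_const_mul, hval] at hle
  rw [integral_Ici_eq_integral_Ioi, ← div_div, div_right_comm, le_div_iff₀ hc, mul_comm]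
  exact hle

/-- Lower bound for the tail of the slope distribution (Mills ratio). -/
lemma le_integral_slopeDensity {p : ℕ} (hp : 3 ≤ p) {c : ℝ} (hc : 0 < c) :
    (1 + c ^ 2) ^ (1 - (p : ℝ) / 2) / (c * (p - 1 + (c ^ 2)⁻¹))
      ≤ ∫ u in Set.Ici c, slopeDensity p u := by
  have hp' : (3 : ℝ) ≤ p := by exact_mod_cast hp
  -- Dividing by `u` instead gives the density times a decreasing factor, largest at `u = c`.
  have hd : ∀ u ∈ Set.Ici c, HasDerivAt (fun u : ℝ => -((1 + u ^ 2) ^ (1 - (p : ℝ) / 2) / u))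
      ((p - 1 + (u ^ 2)⁻¹) * slopeDensity p u) u := fun u hu => by
    have hu0 : 0 < u := hc.trans_le hu
    refine ((hasDerivAt_one_add_sq_rpow (1 - (p : ℝ) / 2) u).div (hasDerivAt_id u)
      hu0.ne').neg.congr_deriv ?_
    have h1 : (1 + u ^ 2) ^ (1 - (p : ℝ) / 2) = (1 + u ^ 2) * (1 + u ^ 2) ^ (-(p : ℝ) / 2) := by
      rw [show 1 - (p : ℝ) / 2 = 1 + -(p : ℝ) / 2 by ring, Real.rpow_add (by positivity),
        Real.rpow_one]
    rw [slopeDensity_eq_rpow, show 1 - (p : ℝ) / 2 - 1 = -(p : ℝ) / 2 by ring, h1]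
    simp only [id]
    field_simp
    ring
  have hpos : ∀ u ∈ Set.Ioi c, 0 ≤ (p - 1 + (u ^ 2)⁻¹) * slopeDensity p u := fun u _ =>
    mul_nonneg (by have : (0 : ℝ) ≤ (u ^ 2)⁻¹ := by positivity
                   linarith) (slopeDensity_pos p u).le
  have hlim : Tendsto (fun u : ℝ => -((1 + u ^ 2) ^ (1 - (p : ℝ) / 2) / u)) atTop (𝓝 (-0)) :=
    ((tendsto_one_add_sq_rpow hp).div_atTop tendsto_id).neg
  have hint := integrableOn_Ioi_deriv_of_nonneg' hd hpos hlim
  have hval := integral_Ioi_of_hasDerivAt_of_nonneg' hd hpos hlim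
  rw [neg_zero, zero_sub, neg_neg] at hval
  have hle : ∫ u in Set.Ioi c, (p - 1 + (u ^ 2)⁻¹) * slopeDensity p u
      ≤ ∫ u in Set.Ioi c, (p - 1 + (c ^ 2)⁻¹) * slopeDensity p u := by
    refine setIntegral_mono_on hint
      ((integrable_slopeDensity (by omega)).integrableOn.const_mul _)
      measurableSet_Ioi fun u hu => mul_le_mul_of_nonneg_right ?_ (slopeDensity_pos p u).le
    have : c ≤ u := le_of_lt hu
    gcongr
  rw [integral_const_mul, hval] at hle
  have hk : 0 < (p : ℝ) - 1 + (c ^ 2)⁻¹ := by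
    have : 0 < (c ^ 2)⁻¹ := by positivity
    linarith
  rw [integral_Ici_eq_integral_Ioi, ← div_div, div_le_iff₀ hk, mul_comm]
  exact hle

end

/-! ### Asymptotics of the cap probability at level `y` -/

/-- The exponent `(4 log n - log log n - y) / p`. -/
noncomputable def capExponent (p : ℕ → ℕ) (y : ℝ) (n : ℕ) : ℝ :=
  (4 * Real.log n - Real.log (Real.log n) - y) / p n

/-- The slope threshold that corresponds to the level `y`. -/
noncomputable def capSlope (p : ℕ → ℕ) (y : ℝ) (n : ℕ) : ℝ :=
  √(Real.exp (capExponent p y n) - 1)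

section Asymptotics

variable {p : ℕ → ℕ}

lemma tendsto_log_natCast : Tendsto (fun n : ℕ => Real.log (n : ℝ)) atTop atTop :=
  Real.tendsto_log_atTop.comp tendsto_natCast_atTop_atTop

lemma tendsto_capExponent_numerator_div_log (y : ℝ) :
    Tendsto (fun n : ℕ => (4 * Real.log (n : ℝ) - Real.log (Real.log n) - y) / Real.log n) atTop
      (𝓝 4) := by
  have h1 : Tendsto (fun x : ℝ => Real.log x / x) atTop (𝓝 0) :=
    Real.isLittleO_log_id_atTop.tendsto_div_nhds_zero
  have h2 : Tendsto (fun x : ℝ => 4 - Real.log x / x - y / x) atTop (𝓝 (4 - 0 - 0)) :=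
    (h1.const_sub 4).sub (tendsto_const_nhds.div_atTop tendsto_id)
  rw [sub_zero, sub_zero] at h2
  refine (h2.comp tendsto_log_natCast).congr' ?_
  filter_upwards [tendsto_log_natCast.eventually_gt_atTop 0] with n hn
  simp only [Function.comp]
  field_simp

lemma eventually_capExponent_pos (hp : Tendsto p atTop atTop) (y : ℝ) :
    ∀ᶠ n in atTop, 0 < capExponent p y n := by
  filter_upwards [hp.eventually_ge_atTop 1, tendsto_log_natCast.eventually_gt_atTop 0,
    (tendsto_capExponent_numerator_div_log y).eventually_const_lt (show (0 : ℝ) < 4 by norm_num)]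
    with n hpn hL h
  have hp0 : (0 : ℝ) < p n := by exact_mod_cast hpn
  exact div_pos ((div_pos_iff_of_pos_right hL).1 h) hp0

lemma tendsto_capExponent
    (hlog : Tendsto (fun n : ℕ => Real.log (n : ℝ) / (p n : ℝ)) atTop (𝓝 0)) (y : ℝ) :
    Tendsto (capExponent p y) atTop (𝓝 0) := by
  have h := (tendsto_capExponent_numerator_div_log y).mul hlog
  rw [mul_zero] at h
  refine h.congr' ?_
  filter_upwards [tendsto_log_natCast.eventually_gt_atTop 0] with n hn
  rw [capExponent]
  field_simp

lemma tendsto_capSlope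
    (hlog : Tendsto (fun n : ℕ => Real.log (n : ℝ) / (p n : ℝ)) atTop (𝓝 0)) (y : ℝ) :
    Tendsto (capSlope p y) atTop (𝓝 0) := by
  have h := ((tendsto_capExponent hlog y).rexp.sub_const 1).sqrt
  rw [Real.exp_zero, sub_self, Real.sqrt_zero] at h
  exact h

lemma capSlope_sq {y : ℝ} {n : ℕ} (h : 0 < capExponent p y n) :
    1 + capSlope p y n ^ 2 = Real.exp (capExponent p y n) := by
  rw [capSlope, Real.sq_sqrt]
  · ring
  · have := Real.one_lt_exp_iff.2 h
    linarith

lemma capSlope_pos {y : ℝ} {n : ℕ} (h : 0 < capExponent p y n) : 0 < capSlope p y n :=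
  Real.sqrt_pos.2 (by have := Real.one_lt_exp_iff.2 h; linarith)

/-- The square of the slope is `exp x - 1 ~ x` as the exponent `x` tends to zero, and `p x ~ 4 log
n`. -/
lemma tendsto_mul_capSlope_sq_div_log (hp : Tendsto p atTop atTop)
    (hlog : Tendsto (fun n : ℕ => Real.log (n : ℝ) / (p n : ℝ)) atTop (𝓝 0)) (y : ℝ) :
    Tendsto (fun n => p n * capSlope p y n ^ 2 / Real.log n) atTop (𝓝 4) := by
  have h1 : Tendsto (fun x : ℝ => (Real.exp x - 1) / x) (𝓝[≠] 0) (𝓝 1) := by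
    have := hasDerivAt_iff_tendsto_slope.1 (Real.hasDerivAt_exp 0)
    rw [Real.exp_zero] at this
    refine this.congr fun x => ?_
    rw [slope_def_field, Real.exp_zero, sub_zero]
  have h2 : Tendsto (capExponent p y) atTop (𝓝[≠] 0) :=
    tendsto_nhdsWithin_iff.2 ⟨tendsto_capExponent hlog y,
      (eventually_capExponent_pos hp y).mono fun n hn => hn.ne'⟩
  have h3 := (h1.comp h2).mul (tendsto_capExponent_numerator_div_log y)
  rw [one_mul] at h3
  refine h3.congr' ?_
  filter_upwards [eventually_capExponent_pos hp y, hp.eventually_ge_atTop 1] with n hn hpn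
  have hp0 : (p n : ℝ) ≠ 0 := by positivity
  have h4 : 4 * Real.log (n : ℝ) - Real.log (Real.log n) - y = capExponent p y n * p n := by
    rw [capExponent, div_mul_cancel₀ _ hp0]
  have h5 : capSlope p y n ^ 2 = Real.exp (capExponent p y n) - 1 := by
    linarith [capSlope_sq hn]
  simp only [Function.comp]
  rw [h4, h5]
  have := hn.ne'
  field_simp

/-- Exactly, `(1 + c²)^(-p/2) = n⁻² √(log n) e^(y/2)`. Since `c ~ 2 √(log n / p)` and the mass is `~
√(2π / p)`, the denominator is `~ 2 √(2π) √(log n)`, and the `√(log n)` cancels. -/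
lemma tendsto_cap_main_term (hp : Tendsto p atTop atTop)
    (hlog : Tendsto (fun n : ℕ => Real.log (n : ℝ) / (p n : ℝ)) atTop (𝓝 0)) (y : ℝ) :
    Tendsto (fun n : ℕ => (n : ℝ) ^ 2 * (1 + capSlope p y n ^ 2) ^ (1 - (p n : ℝ) / 2) /
      (capSlope p y n * p n * slopeMass (p n))) atTop
      (𝓝 (Real.exp (y / 2) / (2 * √(2 * Real.pi)))) := by
  have h1 : Tendsto (fun n => Real.exp (capExponent p y n)) atTop (𝓝 1) := by
    have := (Real.continuous_exp.tendsto 0).comp (tendsto_capExponent hlog y)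
    rwa [Real.exp_zero] at this
  have h2 := (Real.continuous_sqrt.tendsto 4).comp (tendsto_mul_capSlope_sq_div_log hp hlog y)
  have h3 := tendsto_sqrt_mul_slopeMass.comp hp
  have h4 : √4 = (2 : ℝ) := by
    rw [show (4 : ℝ) = 2 ^ 2 by norm_num, Real.sqrt_sq zero_le_two]
  rw [h4] at h2
  have h5 := (h1.mul_const (Real.exp (y / 2))).div (h2.mul h3) (by positivity)
  rw [one_mul] at h5
  refine h5.congr' ?_
  filter_upwards [eventually_capExponent_pos hp y, hp.eventually_ge_atTop 2,
    tendsto_log_natCast.eventually_gt_atTop 0, eventually_ge_atTop 1] with n hn hpn hL hn1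
  have hp0 : (0 : ℝ) < p n := by positivity
  have hn0 : (0 : ℝ) < n := by exact_mod_cast hn1
  have hc := capSlope_pos hn
  have hM := slopeMass_pos hpn
  have hsp : 0 < √(p n : ℝ) := Real.sqrt_pos.2 hp0
  have hsL : 0 < √(Real.log n) := Real.sqrt_pos.2 hL
  simp only [Function.comp, Pi.div_apply]
  have e1 : √(p n * capSlope p y n ^ 2 / Real.log n)
      = √(p n : ℝ) * capSlope p y n / √(Real.log n) := by
    rw [Real.sqrt_div (by positivity), Real.sqrt_mul hp0.le, Real.sqrt_sq hc.le]
  have e2 : (n : ℝ) ^ 2 * (1 + capSlope p y n ^ 2) ^ (1 - (p n : ℝ) / 2)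
      = Real.exp (capExponent p y n) * Real.exp (y / 2) * √(Real.log n) := by
    have h6 : capExponent p y n * p n = 4 * Real.log (n : ℝ) - Real.log (Real.log n) - y := by
      rw [capExponent, div_mul_cancel₀ _ hp0.ne']
    have h7 : √(Real.log n) = Real.exp (Real.log (Real.log n) / 2) := by
      rw [Real.exp_half, Real.exp_log hL]
    have h8 : (n : ℝ) ^ 2 = Real.exp (2 * Real.log n) := by
      rw [two_mul, Real.exp_add, Real.exp_log hn0, sq]
    rw [capSlope_sq hn, ← Real.exp_mul, h7, h8, ← Real.exp_add, ← Real.exp_add, ← Real.exp_add]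
    congr 1
    linear_combination (-1 / 2) * h6
  rw [e1, e2]
  rw [div_eq_div_iff (by positivity) (by positivity)]
  field_simp
  rw [Real.sq_sqrt hp0.le]

/-- The expected number of pairs in a cap of level `y`, up to a factor that tends to `1 / 2`. -/
theorem tendsto_sq_mul_slopeTail (hp : Tendsto p atTop atTop)
    (hlog : Tendsto (fun n : ℕ => Real.log (n : ℝ) / (p n : ℝ)) atTop (𝓝 0)) (y : ℝ) :
    Tendsto (fun n : ℕ => (n : ℝ) ^ 2 * slopeTail (p n) (capSlope p y n)) atTop
      (𝓝 (Real.exp (y / 2) / (2 * √(2 * Real.pi)))) := by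
  have hpR : Tendsto (fun n => (p n : ℝ)) atTop atTop := tendsto_natCast_atTop_atTop.comp hp
  have hinv : Tendsto (fun n => ((p n : ℝ))⁻¹) atTop (𝓝 0) := hpR.inv_tendsto_atTop
  -- `p c² ~ 4 log n` diverges, so both Mills bounds are the main term times a factor tending to
  -- one.
  have hpc : Tendsto (fun n => (p n * capSlope p y n ^ 2)⁻¹) atTop (𝓝 0) := by
    refine Tendsto.inv_tendsto_atTop ?_
    have := (tendsto_mul_capSlope_sq_div_log hp hlog y).pos_mul_atTop (by norm_num)
      tendsto_log_natCast
    refine this.congr' ?_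
    filter_upwards [tendsto_log_natCast.eventually_gt_atTop 0] with n hn
    field_simp
  have hup : Tendsto (fun n => (1 - 2 * (p n : ℝ)⁻¹)⁻¹) atTop (𝓝 1) := by
    have := ((hinv.const_mul 2).const_sub 1).inv₀ (by norm_num)
    simpa using this
  have hlo : Tendsto (fun n => (1 - (p n : ℝ)⁻¹ + (p n * capSlope p y n ^ 2)⁻¹)⁻¹) atTop
      (𝓝 1) := by
    have := ((hinv.const_sub 1).add hpc).inv₀ (by norm_num)
    simpa using this
  have hmain := tendsto_cap_main_term hp hlog y
  have h1 := hmain.mul hup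
  have h2 := hmain.mul hlo
  rw [mul_one] at h1 h2
  refine tendsto_of_tendsto_of_tendsto_of_le_of_le' h2 h1 ?_ ?_
  · filter_upwards [eventually_capExponent_pos hp y, hp.eventually_ge_atTop 3] with n hn hpn
    have hc := capSlope_pos hn
    have hM := slopeMass_pos (p := p n) (by omega)
    have hp3 : (3 : ℝ) ≤ p n := by exact_mod_cast hpn
    have hp0 : (0 : ℝ) < p n := by linarith
    have hle := le_integral_slopeDensity hpn hc
    have hk : 0 < (p n : ℝ) - 1 + (capSlope p y n ^ 2)⁻¹ := by
      have : 0 < (capSlope p y n ^ 2)⁻¹ := by positivity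
      linarith
    have e : 1 - (p n : ℝ)⁻¹ + (p n * capSlope p y n ^ 2)⁻¹
        = ((p n : ℝ) - 1 + (capSlope p y n ^ 2)⁻¹) / p n := by
      rw [mul_inv]; field_simp
    rw [slopeTail, ← mul_div_assoc, le_div_iff₀ hM, e]
    refine le_trans (le_of_eq ?_) (mul_le_mul_of_nonneg_left hle (by positivity))
    generalize (p n : ℝ) - 1 + (capSlope p y n ^ 2)⁻¹ = k at hk
    field_simp
  · filter_upwards [eventually_capExponent_pos hp y, hp.eventually_ge_atTop 3] with n hn hpn
    have hc := capSlope_pos hn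
    have hM := slopeMass_pos (p := p n) (by omega)
    have hp3 : (3 : ℝ) ≤ p n := by exact_mod_cast hpn
    have hp0 : (0 : ℝ) < p n := by linarith
    have hle := integral_slopeDensity_le hpn hc
    have hk : 0 < (p n : ℝ) - 2 := by linarith
    have e : 1 - 2 * (p n : ℝ)⁻¹ = ((p n : ℝ) - 2) / p n := by
      field_simp
    rw [slopeTail, ← mul_div_assoc, div_le_iff₀ hM, e]
    refine (mul_le_mul_of_nonneg_left hle (by positivity)).trans (le_of_eq ?_)
    generalize (p n : ℝ) - 2 = k at hk
    field_simp

/-- For a fixed slope `c > 0` the expected number of pairs in the cap tends to zero. -/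
theorem tendsto_sq_mul_slopeTail_const (hp : Tendsto p atTop atTop)
    (hlog : Tendsto (fun n : ℕ => Real.log (n : ℝ) / (p n : ℝ)) atTop (𝓝 0)) {c : ℝ}
    (hc : 0 < c) :
    Tendsto (fun n : ℕ => (n : ℝ) ^ 2 * slopeTail (p n) c) atTop (𝓝 0) := by
  have hy : Tendsto (fun y : ℝ => Real.exp (y / 2) / (2 * √(2 * Real.pi))) atBot (𝓝 0) := by
    have := (Real.tendsto_exp_atBot.comp (tendsto_id.atBot_div_const (two_pos (α := ℝ)))).div_const
      (2 * √(2 * Real.pi))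
    rwa [zero_div] at this
  refine tendsto_order.2 ⟨fun a ha => Eventually.of_forall fun n =>
    ha.trans_le (mul_nonneg (by positivity) (slopeTail_nonneg _ _)), fun a ha => ?_⟩
  -- A very negative level has limit below `a`, while its threshold slope still tends to zero and so
  -- drops below `c`.
  obtain ⟨y, hya⟩ := (hy.eventually_lt_const ha).exists
  filter_upwards [(tendsto_sq_mul_slopeTail hp hlog y).eventually_lt_const hya,
    (tendsto_capSlope hlog y).eventually_lt_const hc, hp.eventually_ge_atTop 2] with n h1 h2 h3
  exact (mul_le_mul_of_nonneg_left (slopeTail_anti h3 h2.le) (by positivity)).trans_lt h1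

end Asymptotics

/-! ### Dependence between pairs and the void probability -/

/-- The cosine of the angle of a pair. -/
noncomputable def pairCos {n p : ℕ} (x : Fin n → UnitSphere p) (q : PairIdx n) : ℝ :=
  inner ℝ (x q.1.1 : EuclideanSpace ℝ (Fin p)) (x q.1.2)

lemma cos_pairAngle {n p : ℕ} (x : Fin n → UnitSphere p) (q : PairIdx n) :
    Real.cos (pairAngle x q) = pairCos x q := by
  rw [pairAngle, InnerProductGeometry.cos_angle, norm_eq_of_mem_sphere, norm_eq_of_mem_sphere,
    mul_one, div_one, pairCos]

lemma measurable_pairCos {n p : ℕ} (q : PairIdx n) :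
    Measurable fun x : Fin n → UnitSphere p => pairCos x q := by
  unfold pairCos
  fun_prop

lemma card_pairIdx (n : ℕ) : (Fintype.card (PairIdx n) : ℝ) = n * (n - 1) / 2 := by
  have h1 : Fintype.card (PairIdx n)
      = (Finset.univ.filter fun q : Fin n × Fin n => q.1 < q.2).card := Fintype.card_subtype _
  have h2 : (Finset.univ.filter fun q : Fin n × Fin n => q.2 < q.1).card
      = (Finset.univ.filter fun q : Fin n × Fin n => q.1 < q.2).card :=
    Finset.card_equiv (Equiv.prodComm _ _) (by simp)
  have h3 : (Finset.univ.filter fun q : Fin n × Fin n => q.1 < q.2) ∪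
      (Finset.univ.filter fun q : Fin n × Fin n => q.2 < q.1)
      = (Finset.univ : Finset (Fin n)).offDiag := by
    ext q; simp [lt_or_lt_iff_ne]
  have h4 : Disjoint (Finset.univ.filter fun q : Fin n × Fin n => q.1 < q.2)
      (Finset.univ.filter fun q : Fin n × Fin n => q.2 < q.1) :=
    Finset.disjoint_filter.2 fun q _ h => h.asymm
  have h5 := Finset.offDiag_card (Finset.univ : Finset (Fin n))
  rw [← h3, Finset.card_union_of_disjoint h4, h2, ← h1, Finset.card_univ, Fintype.card_fin] at h5
  have h6 : (Fintype.card (PairIdx n) + Fintype.card (PairIdx n)) + n = n * n := by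
    rw [h5, Nat.sub_add_cancel (Nat.le_mul_self n)]
  have h7 : ((Fintype.card (PairIdx n) : ℝ) + Fintype.card (PairIdx n)) + n = n * n := by
    exact_mod_cast h6
  linarith

/-- The pairs that share an index with `q`. -/
def adjacentPairs {n : ℕ} (q : PairIdx n) : Finset (PairIdx n) :=
  Finset.univ.filter fun r => r.1.1 ∈ ({q.1.1, q.1.2} : Finset (Fin n)) ∨
    r.1.2 ∈ ({q.1.1, q.1.2} : Finset (Fin n))

lemma self_mem_adjacentPairs {n : ℕ} (q : PairIdx n) : q ∈ adjacentPairs q := by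
  simp [adjacentPairs]

lemma card_adjacentPairs_le {n : ℕ} (q : PairIdx n) : (adjacentPairs q).card ≤ 4 * n := by
  set S : Finset (Fin n) := {q.1.1, q.1.2} with hS
  have hS2 : S.card ≤ 2 := Finset.card_le_two
  calc (adjacentPairs q).card ≤ ((S ×ˢ Finset.univ) ∪ (Finset.univ ×ˢ S)).card := by
        refine Finset.card_le_card_of_injOn Subtype.val (fun r hr => ?_)
          Subtype.val_injective.injOn
        have := (Finset.mem_filter.1 hr).2
        simpa [hS] using this
    _ ≤ S.card * n + n * S.card := by
        refine (Finset.card_union_le _ _).trans (le_of_eq ?_)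
        simp
    _ ≤ 4 * n := by nlinarith

section Sphere

variable {n p : ℕ}

lemma measurableSet_pairCos_mem {B : Set ℝ} (hB : MeasurableSet B) (q : PairIdx n) :
    MeasurableSet {x : Fin n → UnitSphere p | pairCos x q ∈ B} :=
  measurable_pairCos q hB

/-- The law of `n` independent uniform points of the sphere. -/
noncomputable abbrev uniformSpherePi (n p : ℕ) : Measure (Fin n → UnitSphere p) :=
  Measure.pi fun _ => uniformSphere p

variable [IsProbabilityMeasure (uniformSphere p)]

lemma iIndepFun_eval_uniformSpherePi :
    iIndepFun (fun (i : Fin n) (x : Fin n → UnitSphere p) => x i) (uniformSpherePi n p) :=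
  iIndepFun_pi (X := fun _ y => y) (μ := fun _ : Fin n => uniformSphere p)
    fun _ => measurable_id.aemeasurable

lemma map_eval_uniformSpherePi (i : Fin n) :
    (uniformSpherePi n p).map (fun x => x i) = uniformSphere p :=
  (measurePreserving_eval (fun _ : Fin n => uniformSphere p) i).map_eq

lemma map_eval_prod_uniformSpherePi {i j : Fin n} (hij : i ≠ j) :
    (uniformSpherePi n p).map (fun x => (x i, x j)) = (uniformSphere p).prod (uniformSphere p) := by
  have := (indepFun_iff_map_prod_eq_prod_map_map (measurable_pi_apply i).aemeasurable
    (measurable_pi_apply j).aemeasurable).1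
    ((iIndepFun_eval_uniformSpherePi (n := n) (p := p)).indepFun hij)
  rw [map_eval_uniformSpherePi, map_eval_uniformSpherePi] at this
  exact this

lemma map_eval_prod_prod_uniformSpherePi {i j k : Fin n} (hij : i ≠ j) (hik : i ≠ k)
    (hjk : j ≠ k) :
    (uniformSpherePi n p).map (fun x => ((x j, x k), x i)) =
      ((uniformSphere p).prod (uniformSphere p)).prod (uniformSphere p) := by
  have := (indepFun_iff_map_prod_eq_prod_map_map
    ((measurable_pi_apply j).prodMk (measurable_pi_apply k)).aemeasurable
    (measurable_pi_apply i).aemeasurable).1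
    ((iIndepFun_eval_uniformSpherePi (n := n) (p := p)).indepFun_prodMk
      (fun i => measurable_pi_apply i) j k i hij.symm hik.symm)
  rw [map_eval_uniformSpherePi, map_eval_prod_uniformSpherePi hjk] at this
  exact this

lemma uniformSpherePi_inner_mem {B : Set ℝ} (hB : MeasurableSet B) {b : ENNReal}
    (hb : ∀ e : EuclideanSpace ℝ (Fin p), ‖e‖ = 1 →
      uniformSphere p {x | inner ℝ e (x : EuclideanSpace ℝ (Fin p)) ∈ B} = b)
    {i j : Fin n} (hij : i ≠ j) :
    uniformSpherePi n p
      {x | inner ℝ (x i : EuclideanSpace ℝ (Fin p)) (x j : EuclideanSpace ℝ (Fin p)) ∈ B} = b := by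
  set S : Set (UnitSphere p × UnitSphere p) :=
    {z | inner ℝ (z.1 : EuclideanSpace ℝ (Fin p)) (z.2 : EuclideanSpace ℝ (Fin p)) ∈ B} with hS
  have hSm : MeasurableSet S := (by fun_prop : Measurable fun z : UnitSphere p × UnitSphere p =>
    inner ℝ (z.1 : EuclideanSpace ℝ (Fin p)) (z.2 : EuclideanSpace ℝ (Fin p))) hB
  change uniformSpherePi n p ((fun x => (x i, x j)) ⁻¹' S) = b
  rw [← Measure.map_apply ((measurable_pi_apply i).prodMk (measurable_pi_apply j)) hSm,
    map_eval_prod_uniformSpherePi hij, Measure.prod_apply hSm]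
  have : ∀ e : UnitSphere p, uniformSphere p (Prod.mk e ⁻¹' S) = b := fun e =>
    hb e (norm_eq_of_mem_sphere e)
  simp [this]

/-- Given the common point, the two others are independent and each satisfies its condition with
probability `b`, whatever that point is. -/
lemma uniformSpherePi_inner_mem_inter {B : Set ℝ} (hB : MeasurableSet B) {b : ENNReal}
    (hb : ∀ e : EuclideanSpace ℝ (Fin p), ‖e‖ = 1 →
      uniformSphere p {x | inner ℝ e (x : EuclideanSpace ℝ (Fin p)) ∈ B} = b)
    {i j k : Fin n} (hij : i ≠ j) (hik : i ≠ k) (hjk : j ≠ k) :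
    uniformSpherePi n p
      {x | inner ℝ (x i : EuclideanSpace ℝ (Fin p)) (x j : EuclideanSpace ℝ (Fin p)) ∈ B ∧
        inner ℝ (x i : EuclideanSpace ℝ (Fin p)) (x k : EuclideanSpace ℝ (Fin p)) ∈ B} = b * b := by
  set S : Set ((UnitSphere p × UnitSphere p) × UnitSphere p) :=
    {z | inner ℝ (z.2 : EuclideanSpace ℝ (Fin p)) (z.1.1 : EuclideanSpace ℝ (Fin p)) ∈ B ∧
      inner ℝ (z.2 : EuclideanSpace ℝ (Fin p)) (z.1.2 : EuclideanSpace ℝ (Fin p)) ∈ B} with hS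
  have hSm : MeasurableSet S :=
    ((by fun_prop : Measurable fun z : (UnitSphere p × UnitSphere p) × UnitSphere p =>
      inner ℝ (z.2 : EuclideanSpace ℝ (Fin p)) (z.1.1 : EuclideanSpace ℝ (Fin p))) hB).inter
    ((by fun_prop : Measurable fun z : (UnitSphere p × UnitSphere p) × UnitSphere p =>
      inner ℝ (z.2 : EuclideanSpace ℝ (Fin p)) (z.1.2 : EuclideanSpace ℝ (Fin p))) hB)
  change uniformSpherePi n p ((fun x => ((x j, x k), x i)) ⁻¹' S) = b * b
  rw [← Measure.map_apply (((measurable_pi_apply j).prodMk (measurable_pi_apply k)).prodMk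
    (measurable_pi_apply i)) hSm, map_eval_prod_prod_uniformSpherePi hij hik hjk,
    Measure.prod_apply_symm hSm]
  have : ∀ e : UnitSphere p, ((uniformSphere p).prod (uniformSphere p)) ((fun z => (z, e)) ⁻¹' S)
      = b * b := fun e => by
    have h := hb e (norm_eq_of_mem_sphere e)
    have h2 : (fun z : UnitSphere p × UnitSphere p => (z, e)) ⁻¹' S
        = {x : UnitSphere p | inner ℝ (e : EuclideanSpace ℝ (Fin p))
            (x : EuclideanSpace ℝ (Fin p)) ∈ B} ×ˢ
          {x : UnitSphere p | inner ℝ (e : EuclideanSpace ℝ (Fin p))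
            (x : EuclideanSpace ℝ (Fin p)) ∈ B} := rfl
    rw [h2, Measure.prod_prod, h]
  simp [this]

lemma uniformSpherePi_pairCos_mem {B : Set ℝ} (hB : MeasurableSet B) {b : ENNReal}
    (hb : ∀ e : EuclideanSpace ℝ (Fin p), ‖e‖ = 1 →
      uniformSphere p {x | inner ℝ e (x : EuclideanSpace ℝ (Fin p)) ∈ B} = b) (q : PairIdx n) :
    uniformSpherePi n p {x | pairCos x q ∈ B} = b :=
  uniformSpherePi_inner_mem hB hb q.2.ne

/-- Two distinct adjacent pairs have independent angles. -/
lemma uniformSpherePi_pairCos_mem_inter {B : Set ℝ} (hB : MeasurableSet B) {b : ENNReal}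
    (hb : ∀ e : EuclideanSpace ℝ (Fin p), ‖e‖ = 1 →
      uniformSphere p {x | inner ℝ e (x : EuclideanSpace ℝ (Fin p)) ∈ B} = b) {q r : PairIdx n}
    (hr : r ∈ (adjacentPairs q).erase q) :
    uniformSpherePi n p ({x | pairCos x q ∈ B} ∩ {x | pairCos x r ∈ B}) = b * b := by
  obtain ⟨⟨i, j⟩, hij⟩ := q
  obtain ⟨⟨k, l⟩, hkl⟩ := r
  simp only [adjacentPairs, Finset.mem_erase, Finset.mem_filter, Finset.mem_univ, true_and,
    Finset.mem_insert, Finset.mem_singleton, ne_eq, Subtype.mk.injEq, Prod.mk.injEq] at hr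
  obtain ⟨hne, h⟩ := hr
  simp only at hij hkl
  have key := fun i j k (h1 : i ≠ j) (h2 : i ≠ k) (h3 : j ≠ k) =>
    uniformSpherePi_inner_mem_inter (n := n) hB hb (i := i) (j := j) (k := k) h1 h2 h3
  have hc : ∀ u v : Fin n, ∀ x : Fin n → UnitSphere p,
      inner ℝ (x u : EuclideanSpace ℝ (Fin p)) (x v : EuclideanSpace ℝ (Fin p))
        = inner ℝ (x v : EuclideanSpace ℝ (Fin p)) (x u : EuclideanSpace ℝ (Fin p)) :=
    fun u v x => real_inner_comm _ _
  rcases h with (rfl | rfl) | (rfl | rfl)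
  · exact key k j l hij.ne hkl.ne fun h => hne ⟨rfl, h.symm⟩
  · rw [← key k i l hij.ne' hkl.ne fun h => absurd hkl (by rw [← h]; exact hij.asymm)]
    congr 1; ext x
    simp only [pairCos, Set.mem_inter_iff, Set.mem_ofPred_eq]
    rw [hc i k]
  · rw [← key l j k hij.ne hkl.ne' fun h => absurd hkl (by rw [← h]; exact hij.asymm)]
    congr 1; ext x
    simp only [pairCos, Set.mem_inter_iff, Set.mem_ofPred_eq]
    rw [hc k l]
  · rw [← key l i k hij.ne' hkl.ne' fun h => hne ⟨h.symm, rfl⟩]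
    congr 1; ext x
    simp only [pairCos, Set.mem_inter_iff, Set.mem_ofPred_eq]
    rw [hc k l, hc i l]

/-- A pair is independent of the pairs that share no index with it. -/
lemma indepFun_indicator_occurrences [Nonempty (UnitSphere p)] {B : Set ℝ} (hB : MeasurableSet B)
    (q : PairIdx n) :
    IndepFun ({x : Fin n → UnitSphere p | pairCos x q ∈ B}.indicator fun _ => (1 : ℝ))
      (occurrences (fun r : PairIdx n => {x : Fin n → UnitSphere p | pairCos x r ∈ B})
        (adjacentPairs q)ᶜ) (uniformSpherePi n p) := by
  classical
  set A : PairIdx n → Set (Fin n → UnitSphere p) := fun r => {x | pairCos x r ∈ B} with hA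
  have hAm : ∀ r, MeasurableSet (A r) := fun r => measurableSet_pairCos_mem hB r
  obtain ⟨x₀⟩ := ‹Nonempty (UnitSphere p)›
  set S : Finset (Fin n) := {q.1.1, q.1.2} with hS
  -- Padding with the arbitrary point `x₀` exhibits the two sides as functions of the coordinates in
  -- `S` and in `Sᶜ`.
  let ext : (T : Finset (Fin n)) → (T → UnitSphere p) → Fin n → UnitSphere p :=
    fun T z i => if h : i ∈ T then z ⟨i, h⟩ else x₀
  have hext : ∀ T, Measurable (ext T) := fun T => by
    refine measurable_pi_lambda _ fun i => ?_
    by_cases h : i ∈ T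
    · simp only [ext, h, dite_true]; exact measurable_pi_apply _
    · simp only [ext, h, dite_false]; exact measurable_const
  have hmem : ∀ (T : Finset (Fin n)) (r : PairIdx n), r.1.1 ∈ T → r.1.2 ∈ T → ∀ x,
      (ext T fun i => x i) ∈ A r ↔ x ∈ A r := fun T r h1 h2 x => by
    simp [hA, pairCos, ext, h1, h2]
  have hind := (iIndepFun_eval_uniformSpherePi (n := n) (p := p)).indepFun_finset S Sᶜ
    disjoint_compl_right fun i => measurable_pi_apply i
  have hφ : Measurable fun z : S → UnitSphere p =>
      (A q).indicator (fun _ => (1 : ℝ)) (ext S z) :=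
    (measurable_const.indicator (hAm q)).comp (hext S)
  have hψ : Measurable fun z : (Sᶜ : Finset (Fin n)) → UnitSphere p =>
      occurrences A (adjacentPairs q)ᶜ (ext Sᶜ z) :=
    (measurable_occurrences hAm _).comp (hext Sᶜ)
  have := hind.comp hφ hψ
  convert this using 1
  · funext x
    have := hmem S q (by simp [hS]) (by simp [hS]) x
    simp only [Function.comp, Set.indicator_apply, this]
    rfl
  · funext x
    refine Finset.sum_congr rfl fun r hr => ?_
    have hr' : r.1.1 ∉ S ∧ r.1.2 ∉ S := by
      simpa [adjacentPairs, hS, not_or] using hr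
    have := hmem Sᶜ r (by simpa using hr'.1) (by simpa using hr'.2) x
    simp only [Set.indicator_apply, this]

/-- Poisson approximation of the probability that no pair of uniform points has the cosine of its
angle in `B`. -/
theorem abs_uniformSpherePi_void_sub_exp_le [Nonempty (UnitSphere p)] {B : Set ℝ}
    (hB : MeasurableSet B) {b : ℝ}
    (hb : ∀ e : EuclideanSpace ℝ (Fin p), ‖e‖ = 1 →
      (uniformSphere p).real {x | inner ℝ e (x : EuclideanSpace ℝ (Fin p)) ∈ B} = b) :
    |(uniformSpherePi n p).real (⋃ q : PairIdx n, {x | pairCos x q ∈ B})ᶜ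
        - Real.exp (-(n * (n - 1) / 2 * b))| ≤ 8 * n ^ 3 * b ^ 2 := by
  obtain ⟨x₀⟩ := ‹Nonempty (UnitSphere p)›
  have hb0 : 0 ≤ b := by
    rw [← hb x₀ (norm_eq_of_mem_sphere x₀)]; exact measureReal_nonneg
  have hb' : ∀ e : EuclideanSpace ℝ (Fin p), ‖e‖ = 1 →
      uniformSphere p {x | inner ℝ e (x : EuclideanSpace ℝ (Fin p)) ∈ B} = ENNReal.ofReal b :=
    fun e he => by rw [← hb e he, ofReal_measureReal]
  have h1 : ∀ q : PairIdx n, (uniformSpherePi n p).real {x | pairCos x q ∈ B} = b := fun q => by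
    rw [measureReal_def, uniformSpherePi_pairCos_mem hB hb', ENNReal.toReal_ofReal hb0]
  have h2 : ∀ q : PairIdx n, ∀ r ∈ (adjacentPairs q).erase q,
      (uniformSpherePi n p).real ({x | pairCos x q ∈ B} ∩ {x | pairCos x r ∈ B}) = b * b :=
    fun q r hr => by
      rw [measureReal_def, uniformSpherePi_pairCos_mem_inter hB hb' hr, ENNReal.toReal_mul,
        ENNReal.toReal_ofReal hb0]
  have : Nonempty (UnitSphere p) := ⟨x₀⟩
  have hmain := abs_measureReal_void_sub_exp_le (μ := uniformSpherePi n p)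
    (A := fun q : PairIdx n => {x | pairCos x q ∈ B})
    (fun q => measurableSet_pairCos_mem hB q) adjacentPairs self_mem_adjacentPairs
    (fun q => indepFun_indicator_occurrences hB q)
  simp only [h1] at hmain
  have hsum : ∑ _q : PairIdx n, b = n * (n - 1) / 2 * b := by
    rw [Finset.sum_const, Finset.card_univ, nsmul_eq_mul, card_pairIdx]
  rw [hsum] at hmain
  refine hmain.trans ?_
  -- Each pair has at most `4n` adjacent ones, and each of the two local sums contributes at most
  -- `4n b²`.
  calc _ ≤ ∑ _q : PairIdx n, (8 * n * b ^ 2 : ℝ) := by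
        refine Finset.sum_le_sum fun q _ => ?_
        rw [Finset.sum_congr rfl (h2 q), Finset.sum_const, Finset.sum_const, nsmul_eq_mul,
          nsmul_eq_mul]
        have hc : ((adjacentPairs q).card : ℝ) ≤ 4 * n := by exact_mod_cast card_adjacentPairs_le q
        have hc2 : (((adjacentPairs q).erase q).card : ℝ) ≤ 4 * n :=
          le_trans (by exact_mod_cast Finset.card_erase_le) hc
        nlinarith [mul_nonneg hb0 hb0]
    _ ≤ 8 * n ^ 3 * b ^ 2 := by
        rw [Finset.sum_const, Finset.card_univ, nsmul_eq_mul, card_pairIdx]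
        have hn : (0 : ℝ) ≤ n := Nat.cast_nonneg n
        have h5 : (0 : ℝ) ≤ n * b ^ 2 := by positivity
        have h6 : (n : ℝ) * (n - 1) / 2 ≤ n ^ 2 := by nlinarith
        nlinarith

/-- The union bound over all pairs. -/
lemma uniformSpherePi_real_iUnion_le {B : Set ℝ}
    (hB : MeasurableSet B) {b : ℝ} (hb0 : 0 ≤ b)
    (hb : ∀ e : EuclideanSpace ℝ (Fin p), ‖e‖ = 1 →
      (uniformSphere p).real {x | inner ℝ e (x : EuclideanSpace ℝ (Fin p)) ∈ B} = b) :
    (uniformSpherePi n p).real (⋃ q : PairIdx n, {x | pairCos x q ∈ B}) ≤ n ^ 2 * b := by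
  have hb' : ∀ e : EuclideanSpace ℝ (Fin p), ‖e‖ = 1 →
      uniformSphere p {x | inner ℝ e (x : EuclideanSpace ℝ (Fin p)) ∈ B} = ENNReal.ofReal b :=
    fun e he => by rw [← hb e he, ofReal_measureReal]
  refine (measureReal_iUnion_fintype_le _).trans ?_
  have h1 : ∀ q : PairIdx n, (uniformSpherePi n p).real {x | pairCos x q ∈ B} = b := fun q => by
    rw [measureReal_def, uniformSpherePi_pairCos_mem hB hb', ENNReal.toReal_ofReal hb0]
  simp only [h1]
  rw [Finset.sum_const, Finset.card_univ, nsmul_eq_mul, card_pairIdx]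
  have hn : (0 : ℝ) ≤ n := Nat.cast_nonneg n
  have h6 : (n : ℝ) * (n - 1) / 2 ≤ n ^ 2 := by nlinarith
  exact mul_le_mul_of_nonneg_right h6 hb0

end Sphere

/-! ### From caps to the rescaled extreme angle -/

lemma slopeCos_sq (c : ℝ) : slopeCos c ^ 2 = 1 - (1 + c ^ 2)⁻¹ := by
  rw [slopeCos, div_pow, Real.sq_sqrt (by positivity)]
  field_simp
  ring

lemma uniformSphere_real_signed_cap {p : ℕ} (hp : 2 ≤ p) {σ : ℝ} (hσ : |σ| = 1) (c : ℝ)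
    {e : EuclideanSpace ℝ (Fin p)} (he : ‖e‖ = 1) :
    (uniformSphere p).real {x | inner ℝ e (x : EuclideanSpace ℝ (Fin p)) ∈
      {s : ℝ | slopeCos c ≤ σ * s}} = slopeTail p c := by
  rw [← uniformSphere_real_cap hp (e := σ • e) (by rw [norm_smul, Real.norm_eq_abs, hσ, he, one_mul])
    c]
  congr 1; ext x
  simp [real_inner_smul_left]

lemma uniformSphere_real_signed_pole {p : ℕ} (hp : 2 ≤ p) {σ : ℝ} (hσ : |σ| = 1)
    {e : EuclideanSpace ℝ (Fin p)} (he : ‖e‖ = 1) :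
    (uniformSphere p).real {x | inner ℝ e (x : EuclideanSpace ℝ (Fin p)) ∈
      {s : ℝ | σ * s = 1}} = 0 := by
  rw [← uniformSphere_real_pole hp (e := σ • e) (by rw [norm_smul, Real.norm_eq_abs, hσ, he, one_mul])]
  congr 1; ext x
  simp [real_inner_smul_left]

lemma measurableSet_signed_cap (σ t : ℝ) : MeasurableSet {s : ℝ | t ≤ σ * s} :=
  measurableSet_le measurable_const (by fun_prop)

lemma measurableSet_signed_pole (σ : ℝ) : MeasurableSet {s : ℝ | σ * s = 1} :=
  measurableSet_eq_fun (by fun_prop) measurable_const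

lemma nonempty_unitSphere {p : ℕ} (hp : 1 ≤ p) : Nonempty (UnitSphere p) := by
  have : Nonempty (Fin p) := ⟨⟨0, hp⟩⟩
  exact (NormedSpace.sphere_nonempty.2 zero_le_one).to_subtype

section Limit

variable {p : ℕ → ℕ}

/-- The probability that some pair falls into the cap of level `y`. -/
lemma tendsto_uniformSpherePi_real_iUnion (hp : Tendsto p atTop atTop)
    (hlog : Tendsto (fun n : ℕ => Real.log (n : ℝ) / (p n : ℝ)) atTop (𝓝 0)) {σ : ℝ}
    (hσ : |σ| = 1) (y : ℝ) :
    Tendsto (fun n => (uniformSpherePi n (p n)).real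
      (⋃ q : PairIdx n, {x | pairCos x q ∈ {s : ℝ | slopeCos (capSlope p y n) ≤ σ * s}})) atTop
      (𝓝 (1 - Real.exp (-(1 / (4 * √(2 * Real.pi))) * Real.exp (y / 2)))) := by
  have hmain := tendsto_sq_mul_slopeTail hp hlog y
  have hninv : Tendsto (fun n : ℕ => ((n : ℝ))⁻¹) atTop (𝓝 0) :=
    tendsto_natCast_atTop_atTop.inv_tendsto_atTop
  have hl : Tendsto (fun n : ℕ => (n : ℝ) * (n - 1) / 2 * slopeTail (p n) (capSlope p y n)) atTop
      (𝓝 (1 / (4 * √(2 * Real.pi)) * Real.exp (y / 2))) := by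
    have h := ((hninv.const_sub 1).div_const 2).mul hmain
    have e : (1 - 0) / 2 * (Real.exp (y / 2) / (2 * √(2 * Real.pi)))
        = 1 / (4 * √(2 * Real.pi)) * Real.exp (y / 2) := by
      field_simp; norm_num
    rw [e] at h
    refine h.congr' ?_
    filter_upwards [eventually_ge_atTop 1] with n hn
    have : (n : ℝ) ≠ 0 := by positivity
    field_simp
  have hexp : Tendsto (fun n : ℕ => 1 -
      Real.exp (-((n : ℝ) * (n - 1) / 2 * slopeTail (p n) (capSlope p y n)))) atTop
      (𝓝 (1 - Real.exp (-(1 / (4 * √(2 * Real.pi))) * Real.exp (y / 2)))) := by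
    rw [neg_mul]
    exact hl.neg.rexp.const_sub 1
  have herr : Tendsto (fun n : ℕ => 8 * (n : ℝ) ^ 3 * slopeTail (p n) (capSlope p y n) ^ 2) atTop
      (𝓝 0) := by
    -- The error is `8 (n² b)² / n` with `n² b` convergent.
    have h := ((hmain.pow 2).const_mul 8).mul hninv
    rw [mul_zero] at h
    refine h.congr' ?_
    filter_upwards [eventually_ge_atTop 1] with n hn
    have : (n : ℝ) ≠ 0 := by positivity
    field_simp
  refine tendsto_of_tendsto_of_dist hexp (squeeze_zero' (Eventually.of_forall fun _ => dist_nonneg)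
    ?_ herr)
  filter_upwards [hp.eventually_ge_atTop 2] with n hn
  have := isProbabilityMeasure_uniformSphere (p := p n) (by omega)
  have := nonempty_unitSphere (p := p n) (by omega)
  have hB := measurableSet_signed_cap σ (slopeCos (capSlope p y n))
  have h := abs_uniformSpherePi_void_sub_exp_le (n := n) hB
    fun e he => uniformSphere_real_signed_cap hn hσ (capSlope p y n) he
  rw [probReal_compl_eq_one_sub (MeasurableSet.iUnion fun q => measurableSet_pairCos_mem hB q)] at h
  rw [Real.dist_eq]
  rw [sub_right_comm] at h
  exact h

/-- This controls the exceptional event that one fixed pair lies in the opposite cap. -/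
lemma tendsto_slopeTail_capSlope (hp : Tendsto p atTop atTop)
    (hlog : Tendsto (fun n : ℕ => Real.log (n : ℝ) / (p n : ℝ)) atTop (𝓝 0)) (y : ℝ) :
    Tendsto (fun n => slopeTail (p n) (capSlope p y n)) atTop (𝓝 0) := by
  have hninv : Tendsto (fun n : ℕ => ((n : ℝ))⁻¹) atTop (𝓝 0) :=
    tendsto_natCast_atTop_atTop.inv_tendsto_atTop
  have h := (tendsto_sq_mul_slopeTail hp hlog y).mul (hninv.pow 2)
  rw [zero_pow two_ne_zero, mul_zero] at h
  refine h.congr' ?_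
  filter_upwards [eventually_ge_atTop 1] with n hn
  have : (n : ℝ) ≠ 0 := by positivity
  field_simp

/-- The rescaled logarithm of the sine of an angle. -/
noncomputable def rescaledLogSin (p : ℕ → ℕ) (n : ℕ) (θ : ℝ) : ℝ :=
  2 * (p n : ℝ) * Real.log (Real.sin θ) + 4 * Real.log (n : ℝ) - Real.log (Real.log (n : ℝ))

/-- The left side says `sin² θ ≤ exp (-x)` for the exponent `x`, that is `|σ cos θ| ≥ t` with `t² =
1 - exp (-x)`; `h2` excludes the negative alternative. `h1` excludes `sin θ = 0`, where `Real.log 0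
= 0` would spoil the equivalence. -/
lemma rescaledLogSin_le_iff {y θ σ : ℝ} {n : ℕ} (hpn : 1 ≤ p n) (hx : 0 < capExponent p y n)
    (hσ : |σ| = 1) (hθ : 0 ≤ Real.sin θ) (h1 : σ * Real.cos θ ≠ 1)
    (h2 : -slopeCos (capSlope p y n) < σ * Real.cos θ) :
    rescaledLogSin p n θ ≤ y ↔ slopeCos (capSlope p y n) ≤ σ * Real.cos θ := by
  have hp0 : (0 : ℝ) < p n := by exact_mod_cast hpn
  have hσ2 : σ ^ 2 = 1 := by rw [← sq_abs, hσ, one_pow]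
  set t := slopeCos (capSlope p y n) with ht
  set C := σ * Real.cos θ with hC
  have hC2 : C ^ 2 = 1 - Real.sin θ ^ 2 := by
    rw [hC, mul_pow, hσ2, one_mul, Real.cos_sq']
  have ht1 : t < 1 := slopeCos_lt_one _
  have ht0 : 0 ≤ t := div_nonneg (Real.sqrt_nonneg _) (Real.sqrt_nonneg _)
  have ht2 : t ^ 2 = 1 - Real.exp (-capExponent p y n) := by
    rw [ht, slopeCos_sq, capSlope_sq hx, Real.exp_neg]
  have hC1 : C < 1 := by
    refine lt_of_le_of_ne ?_ h1
    nlinarith [sq_nonneg (Real.sin θ)]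
  have hs : 0 < Real.sin θ := by
    refine lt_of_le_of_ne hθ fun h => ?_
    rw [← h] at hC2
    nlinarith
  have h3 : capExponent p y n * p n = 4 * Real.log (n : ℝ) - Real.log (Real.log n) - y := by
    rw [capExponent, div_mul_cancel₀ _ hp0.ne']
  have h4 : rescaledLogSin p n θ ≤ y ↔ Real.log (Real.sin θ ^ 2) ≤ -capExponent p y n := by
    rw [Real.log_pow, rescaledLogSin]
    push_cast
    constructor
    · intro h
      refine le_of_mul_le_mul_right ?_ hp0
      linarith
    · intro h
      have := mul_le_mul_of_nonneg_right h hp0.le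
      linarith
  rw [h4, Real.log_le_iff_le_exp (by positivity)]
  constructor
  · intro h
    by_contra hlt
    push Not at hlt
    nlinarith
  · intro h
    nlinarith

lemma abs_measureReal_sub_le_of_subset {α : Type*} [MeasurableSpace α] {μ : Measure α}
    [IsFiniteMeasure μ] {s t u : Set α} (h1 : s ⊆ t ∪ u) (h2 : t ⊆ s ∪ u) :
    |μ.real s - μ.real t| ≤ μ.real u := by
  have h3 := (measureReal_mono (μ := μ) h1).trans (measureReal_union_le t u)
  have h4 := (measureReal_mono (μ := μ) h2).trans (measureReal_union_le s u)
  rw [abs_le]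
  constructor <;> linarith

lemma sin_pairAngle_nonneg {n p : ℕ} (x : Fin n → UnitSphere p) (q : PairIdx n) :
    0 ≤ Real.sin (pairAngle x q) :=
  Real.sin_nonneg_of_nonneg_of_le_pi (InnerProductGeometry.angle_nonneg _ _)
    (InnerProductGeometry.angle_le_pi _ _)

/-- The limit of the distribution functions of the rescaled extreme angle, `f n` being the smallest
angle if `σ = 1` and the largest one if `σ = -1`. -/
theorem tendsto_uniformSpherePi_real_rescaledLogSin_le (hp : Tendsto p atTop atTop)
    (hlog : Tendsto (fun n : ℕ => Real.log (n : ℝ) / (p n : ℝ)) atTop (𝓝 0)) {σ : ℝ}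
    (hσ : |σ| = 1) (f : ∀ n, (Fin n → UnitSphere (p n)) → ℝ)
    (hf : ∀ n, 2 ≤ n → ∀ x, ∃ q : PairIdx n, f n x = pairAngle x q ∧
      ∀ r, σ * pairCos x r ≤ σ * pairCos x q) (y : ℝ) :
    Tendsto (fun n => (uniformSpherePi n (p n)).real {x | rescaledLogSin p n (f n x) ≤ y}) atTop
      (𝓝 (1 - Real.exp (-(1 / (4 * √(2 * Real.pi))) * Real.exp (y / 2)))) := by
  refine tendsto_of_tendsto_of_dist (tendsto_uniformSpherePi_real_iUnion hp hlog hσ y)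
    (squeeze_zero' (Eventually.of_forall fun _ => dist_nonneg) ?_
      (tendsto_slopeTail_capSlope hp hlog y))
  filter_upwards [hp.eventually_ge_atTop 2, eventually_ge_atTop 2,
    eventually_capExponent_pos hp y] with n hpn hn hx
  have := isProbabilityMeasure_uniformSphere (p := p n) (by omega)
  set t := slopeCos (capSlope p y n) with ht
  set q₀ : PairIdx n := ⟨(⟨0, by omega⟩, ⟨1, by omega⟩), by simp⟩ with hq₀
  -- If the extremal pair lies in the opposite cap, so does every pair; testing the single pair `q₀`
  -- avoids a union bound.
  set U : Set (Fin n → UnitSphere (p n)) := {x | pairCos x q₀ ∈ {s : ℝ | t ≤ -σ * s}} with hU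
  set U' : Set (Fin n → UnitSphere (p n)) :=
    ⋃ q : PairIdx n, {x | pairCos x q ∈ {s : ℝ | σ * s = 1}} with hU'
  have hUm : (uniformSpherePi n (p n)).real U = slopeTail (p n) (capSlope p y n) := by
    have hb : ∀ e : EuclideanSpace ℝ (Fin (p n)), ‖e‖ = 1 → uniformSphere (p n)
        {x | inner ℝ e (x : EuclideanSpace ℝ (Fin (p n))) ∈ {s : ℝ | t ≤ -σ * s}}
          = ENNReal.ofReal (slopeTail (p n) (capSlope p y n)) := fun e he => by
      rw [← uniformSphere_real_signed_cap hpn (σ := -σ) (by rwa [abs_neg]) (capSlope p y n) he,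
        ofReal_measureReal]
    rw [measureReal_def, hU, uniformSpherePi_pairCos_mem (measurableSet_signed_cap (-σ) t) hb,
      ENNReal.toReal_ofReal (slopeTail_nonneg _ _)]
  have hUm' : (uniformSpherePi n (p n)).real U' ≤ 0 := by
    have := uniformSpherePi_real_iUnion_le (n := n) (measurableSet_signed_pole σ) le_rfl
      fun e he => uniformSphere_real_signed_pole hpn hσ he
    rwa [mul_zero] at this
  have hiff : ∀ x, x ∉ U ∪ U' → (rescaledLogSin p n (f n x) ≤ y ↔
      x ∈ ⋃ q : PairIdx n, {x | pairCos x q ∈ {s : ℝ | t ≤ σ * s}}) := by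
    intro x hxU
    rw [Set.mem_union, not_or] at hxU
    obtain ⟨q, hq, hmax⟩ := hf n hn x
    have h1 : ¬ t ≤ -σ * pairCos x q₀ := hxU.1
    have h2 : σ * pairCos x q ≠ 1 := fun h => hxU.2 (Set.mem_iUnion.2 ⟨q, h⟩)
    have h3 := hmax q₀
    rw [hq, rescaledLogSin_le_iff (by omega) hx hσ (sin_pairAngle_nonneg x q)
      (by rwa [cos_pairAngle]) (by rw [cos_pairAngle]; linarith), cos_pairAngle, Set.mem_iUnion]
    exact ⟨fun h => ⟨q, h⟩, fun ⟨r, hr⟩ => le_trans hr (hmax r)⟩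
  rw [dist_comm, Real.dist_eq]
  refine (abs_measureReal_sub_le_of_subset (u := U ∪ U') ?_ ?_).trans
    ((measureReal_union_le U U').trans (by linarith))
  · intro x hx
    by_cases h : x ∈ U ∪ U'
    · exact Or.inr h
    · exact Or.inl ((hiff x h).1 hx)
  · intro x hx
    by_cases h : x ∈ U ∪ U'
    · exact Or.inr h
    · exact Or.inl ((hiff x h).2 hx)

end Limit

/-! ### Extremal pairs and deviations from the right angle -/

section Angles

variable {n p : ℕ}

lemma nonempty_pairIdx (hn : 2 ≤ n) : Nonempty (PairIdx n) :=
  ⟨⟨(⟨0, by omega⟩, ⟨1, by omega⟩), by simp⟩⟩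

lemma measurable_pairAngle (q : PairIdx n) :
    Measurable fun x : Fin n → UnitSphere p => pairAngle x q := by
  have : (fun x : Fin n → UnitSphere p => pairAngle x q) = fun x => Real.arccos (pairCos x q) := by
    funext x
    rw [← cos_pairAngle]
    exact (Real.arccos_cos (InnerProductGeometry.angle_nonneg _ _)
      (InnerProductGeometry.angle_le_pi _ _)).symm
  rw [this]
  exact Real.continuous_arccos.measurable.comp (measurable_pairCos q)

lemma measurable_angleMin : Measurable (angleMin : (Fin n → UnitSphere p) → ℝ) :=
  Measurable.iInf measurable_pairAngle

lemma measurable_angleMax : Measurable (angleMax : (Fin n → UnitSphere p) → ℝ) :=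
  Measurable.iSup measurable_pairAngle

lemma measurable_angleMaxDev : Measurable (angleMaxDev : (Fin n → UnitSphere p) → ℝ) :=
  Measurable.iSup fun q => ((measurable_pairAngle q).sub_const _).norm

lemma pairCos_le_of_pairAngle_le {x : Fin n → UnitSphere p} {q r : PairIdx n}
    (h : pairAngle x q ≤ pairAngle x r) : pairCos x r ≤ pairCos x q := by
  rw [← cos_pairAngle, ← cos_pairAngle]
  exact Real.cos_le_cos_of_nonneg_of_le_pi (InnerProductGeometry.angle_nonneg _ _)
    (InnerProductGeometry.angle_le_pi _ _) h

lemma exists_angleMin_eq (hn : 2 ≤ n) (x : Fin n → UnitSphere p) :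
    ∃ q : PairIdx n, angleMin x = pairAngle x q ∧ ∀ r, 1 * pairCos x r ≤ 1 * pairCos x q := by
  have := nonempty_pairIdx hn
  obtain ⟨q, hq⟩ := exists_eq_ciInf_of_finite (f := fun q => pairAngle x q)
  refine ⟨q, hq.symm, fun r => ?_⟩
  rw [one_mul, one_mul]
  refine pairCos_le_of_pairAngle_le ?_
  rw [hq]
  exact ciInf_le (Set.finite_range _).bddBelow r

lemma exists_angleMax_eq (hn : 2 ≤ n) (x : Fin n → UnitSphere p) :
    ∃ q : PairIdx n, angleMax x = pairAngle x q ∧ ∀ r, -1 * pairCos x r ≤ -1 * pairCos x q := by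
  have := nonempty_pairIdx hn
  obtain ⟨q, hq⟩ := exists_eq_ciSup_of_finite (f := fun q => pairAngle x q)
  refine ⟨q, hq.symm, fun r => ?_⟩
  rw [neg_one_mul, neg_one_mul, neg_le_neg_iff]
  refine pairCos_le_of_pairAngle_le ?_
  rw [hq]
  exact le_ciSup (f := fun q => pairAngle x q) (Set.finite_range _).bddAbove r

/-- If some angle deviates from `π / 2` by `ε`, then some pair falls into one of two opposite
caps. -/
lemma setOf_le_angleMaxDev_subset (hn : 2 ≤ n) {ε : ℝ} (hε0 : 0 < ε) (hε : ε < Real.pi / 2) :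
    {x : Fin n → UnitSphere p | ε ≤ angleMaxDev x} ⊆
      (⋃ q : PairIdx n, {x | pairCos x q ∈ {s : ℝ | slopeCos (Real.tan ε) ≤ 1 * s}}) ∪
      ⋃ q : PairIdx n, {x | pairCos x q ∈ {s : ℝ | slopeCos (Real.tan ε) ≤ -1 * s}} := by
  intro x hx
  have := nonempty_pairIdx hn
  obtain ⟨q, hq⟩ := exists_eq_ciSup_of_finite (f := fun q => |pairAngle x q - Real.pi / 2|)
  have h1 : ε ≤ |pairAngle x q - Real.pi / 2| := by
    rw [hq]; exact hx
  have hcos : 0 < Real.cos ε := Real.cos_pos_of_mem_Ioo ⟨by linarith, hε⟩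
  -- A deviation `ε` from `π / 2` corresponds to the slope `tan ε`.
  have h2 : slopeCos (Real.tan ε) = Real.sin ε := Real.tan_div_sqrt_one_add_tan_sq hcos
  have h3 : Real.sin (Real.pi / 2 - pairAngle x q) = pairCos x q := by
    rw [Real.sin_pi_div_two_sub, cos_pairAngle]
  have h0 : 0 ≤ pairAngle x q := InnerProductGeometry.angle_nonneg _ _
  have hpi : pairAngle x q ≤ Real.pi := InnerProductGeometry.angle_le_pi _ _
  rcases le_abs'.1 h1 with h | h
  · refine Or.inl (Set.mem_iUnion.2 ⟨q, ?_⟩)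
    simp only [Set.mem_ofPred_eq]
    rw [h2, one_mul, ← h3]
    exact Real.sin_le_sin_of_le_of_le_pi_div_two (by linarith) (by linarith) (by linarith)
  · refine Or.inr (Set.mem_iUnion.2 ⟨q, ?_⟩)
    simp only [Set.mem_ofPred_eq]
    rw [h2, neg_one_mul, ← h3, ← Real.sin_neg]
    exact Real.sin_le_sin_of_le_of_le_pi_div_two (by linarith) (by linarith) (by linarith)

end Angles

/-! ### Conclusion -/

/-- The angles of independent uniform points are uniformly close to `π / 2`. -/
theorem tendsto_uniformSpherePi_le_angleMaxDev {p : ℕ → ℕ} (hp : Tendsto p atTop atTop)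
    (hlog : Tendsto (fun n : ℕ => Real.log (n : ℝ) / (p n : ℝ)) atTop (𝓝 0)) {ε : ℝ}
    (hε : 0 < ε) :
    Tendsto (fun n => uniformSpherePi n (p n) {x | ε ≤ angleMaxDev x}) atTop (𝓝 0) := by
  -- Shrinking the deviation only enlarges the event and keeps `tan δ` positive, since `1 < π / 2`.
  set δ := min ε 1 with hδ
  have hδ0 : 0 < δ := lt_min hε one_pos
  have hδ1 : δ < Real.pi / 2 := (min_le_right _ _).trans_lt (by linarith [Real.pi_gt_three])
  have h := (tendsto_sq_mul_slopeTail_const hp hlog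
    (Real.tan_pos_of_pos_of_lt_pi_div_two hδ0 hδ1)).const_mul 2
  rw [mul_zero] at h
  have h' := ENNReal.tendsto_ofReal h
  rw [ENNReal.ofReal_zero] at h'
  refine tendsto_of_tendsto_of_tendsto_of_le_of_le' tendsto_const_nhds h'
    (Eventually.of_forall fun _ => zero_le) ?_
  filter_upwards [hp.eventually_ge_atTop 2, eventually_ge_atTop 2] with n hpn hn
  have := isProbabilityMeasure_uniformSphere (p := p n) (by omega)
  have hcap : ∀ σ : ℝ, |σ| = 1 → (uniformSpherePi n (p n)).real
      (⋃ q : PairIdx n, {x | pairCos x q ∈ {s : ℝ | slopeCos (Real.tan δ) ≤ σ * s}})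
        ≤ n ^ 2 * slopeTail (p n) (Real.tan δ) := fun σ hσ =>
    uniformSpherePi_real_iUnion_le (measurableSet_signed_cap σ _) (slopeTail_nonneg _ _)
      fun e he => uniformSphere_real_signed_cap hpn hσ _ he
  have h1 := hcap 1 (by simp)
  have h2 := hcap (-1) (by simp)
  rw [← ofReal_measureReal]
  refine ENNReal.ofReal_le_ofReal ?_
  have hsub : {x : Fin n → UnitSphere (p n) | ε ≤ angleMaxDev x} ⊆ _ :=
    Set.Subset.trans (fun x hx => (min_le_left ε 1).trans hx)
      (setOf_le_angleMaxDev_subset hn hδ0 hδ1)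
  refine (measureReal_mono hsub).trans ((measureReal_union_le _ _).trans ?_)
  linarith

/-- Convergence in distribution from the convergence of the distribution functions under the law
of independent uniform points. -/
lemma tendstoInDistribution_of_tendsto_uniformSpherePi {Ω : ℕ → Type*}
    [∀ n, MeasurableSpace (Ω n)] {P : ∀ n, Measure (Ω n)} [∀ n, IsProbabilityMeasure (P n)]
    {p : ℕ → ℕ} {X : ∀ n, Ω n → Fin n → UnitSphere (p n)}
    (hX : ∀ n, HasLaw (X n) (uniformSpherePi n (p n)) (P n))
    {Y : ∀ n, (Fin n → UnitSphere (p n)) → ℝ} (hY : ∀ n, Measurable (Y n)) {ν : Measure ℝ}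
    [IsProbabilityMeasure ν]
    (h : ∀ y, Tendsto (fun n => (uniformSpherePi n (p n)).real {x | Y n x ≤ y}) atTop
      (𝓝 (cdf ν y))) :
    TendstoInDistribution (fun n ω => Y n (X n ω)) atTop (id : ℝ → ℝ) P ν where
  forall_aemeasurable n := (hY n).comp_aemeasurable (hX n).aemeasurable
  tendsto := by
    refine tendsto_probabilityMeasure_of_tendsto_Iic fun y => ?_
    simp only [ProbabilityMeasure.coe_mk, Measure.map_id]
    rw [← cdf_eq_real]
    refine (h y).congr fun n => ?_
    rw [map_measureReal_apply_of_aemeasurable (f := fun ω => Y n (X n ω)) ((hY n).comp_aemeasurable (hX n).aemeasurable)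
      measurableSet_Iic]
    exact ((hX n).measureReal_eq (measurableSet_le (hY n) measurable_const)).symm

theorem theorem5
    {Ω : ℕ → Type*} [∀ n, MeasurableSpace (Ω n)]
    (P : ∀ n, Measure (Ω n)) [∀ n, IsProbabilityMeasure (P n)]
    (p : ℕ → ℕ)
    (hp : Tendsto p atTop atTop)
    (hlog : Tendsto (fun n : ℕ => Real.log (n : ℝ) / (p n : ℝ)) atTop (𝓝 0))
    (X : ∀ n, Fin n → Ω n → UnitSphere (p n))
    (hlaw : ∀ n, ∀ i : Fin n, HasLaw (X n i) (uniformSphere (p n)) (P n))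
    (hindep : ∀ n, iIndepFun (X n) (P n)) :
    (∀ ε : ℝ, 0 < ε →
      Tendsto (fun n : ℕ => P n {ω | ε ≤ angleMaxDev (fun i => X n i ω)}) atTop (𝓝 0)) ∧
    ∃ (ν : Measure ℝ) (_ : IsProbabilityMeasure ν),
      (∀ y : ℝ, cdf ν y =
        1 - Real.exp (-(1 / (4 * Real.sqrt (2 * Real.pi))) * Real.exp (y / 2))) ∧
      TendstoInDistribution
        (fun (n : ℕ) (ω : Ω n) =>
          2 * (p n : ℝ) * Real.log (Real.sin (angleMin (fun i => X n i ω)))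
            + 4 * Real.log (n : ℝ) - Real.log (Real.log (n : ℝ)))
        atTop (id : ℝ → ℝ) P ν ∧
      TendstoInDistribution
        (fun (n : ℕ) (ω : Ω n) =>
          2 * (p n : ℝ) * Real.log (Real.sin (angleMax (fun i => X n i ω)))
            + 4 * Real.log (n : ℝ) - Real.log (Real.log (n : ℝ)))
        atTop (id : ℝ → ℝ) P ν := by
  have hX : ∀ n, HasLaw (fun ω i => X n i ω) (uniformSpherePi n (p n)) (P n) := fun n =>
    (hindep n).hasLaw_pi (hlaw n)
  have hK : 0 < 1 / (4 * √(2 * Real.pi)) := by positivity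
  obtain ⟨ν, hν, hcdf⟩ := exists_extreme_law hK
  have hY : ∀ n, Measurable (rescaledLogSin p n) := fun n => by
    unfold rescaledLogSin
    fun_prop
  refine ⟨fun ε hε => ?_, ν, hν, hcdf, ?_, ?_⟩
  · refine (tendsto_uniformSpherePi_le_angleMaxDev hp hlog hε).congr fun n => ?_
    exact ((hX n).measure_eq (measurableSet_le measurable_const measurable_angleMaxDev)).symm
  · refine tendstoInDistribution_of_tendsto_uniformSpherePi hX
      (Y := fun n x => rescaledLogSin p n (angleMin x))
      (fun n => (hY n).comp measurable_angleMin) fun y => ?_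
    rw [hcdf]
    exact tendsto_uniformSpherePi_real_rescaledLogSin_le hp hlog abs_one (fun n => angleMin)
      (fun n hn x => exists_angleMin_eq hn x) y
  · refine tendstoInDistribution_of_tendsto_uniformSpherePi hX
      (Y := fun n x => rescaledLogSin p n (angleMax x))
      (fun n => (hY n).comp measurable_angleMax) fun y => ?_
    rw [hcdf]
    exact tendsto_uniformSpherePi_real_rescaledLogSin_le hp hlog (by simp) (fun n => angleMax)
      (fun n hn x => exists_angleMax_eq hn x) y
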